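/- For $k\ge 1$ let $(\mathbb{C}^k)^\circ$ be the set of $(m_1,\dots,m_k)\in\mathbb{C}^k$ such that $\sum_{i\in S}m_i\neq 0$ for every nonempty $S\subseteq\{1,\dots,k\}$; it contains $\mathbb{N}^k$, where $\mathbb{N}=\{1,2,3,\dots\}$. For $n\ge 0$ put $$e_n(m_1,\dots,m_k,x_1,\dots,x_k)=\sum_{i_1+\dots+i_k=n}\binom{m_1}{i_1}\cdots\binom{m_k}{i_k}\,x_1^{i_1}\cdots x_k^{i_k},$$ which is $(-1)^n$ times the coefficient of $z^{m_1+\dots+m_k-n}$ in $(z-x_1)^{m_1}\cdots(z-x_k)^{m_k}$. For $P=(m_1,\dots,m_k)\in(\mathbb{C}^k)^\circ$ let $\Delta^k_P=\operatorname{Spec}\mathbb{C}[e_1(P,x),e_2(P,x),\dots]$, where $\mathbb{C}[e_1(P,x),e_2(P,x),\dots]\subseteq\mathbb{C}[x_1,\dots,x_k]$, be the incidence stratum of $\mathbb{A}^1$ with weights $P$. (For $P\in\mathbb{N}^k$ with $d=m_1+\dots+m_k$ this is the closed subvariety $\{(z-x_1)^{m_1}\cdots(z-x_k)^{m_k}\mid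 x_1,\dots,x_k\in\mathbb{C}\}$ of the space $\mathbb{A}^d$ of monic polynomials of degree $d$.) Let $$N_k(P)=\min\{n\mid \Delta^k_P\text{ embeds into }\mathbb{A}^n\},$$ where an embedding is a closed immersion over $\mathbb{C}$. Further, let $B_k=\mathbb{C}[m_1,\dots,m_k]\big[\{1/\sum_{i\in S}m_i\}_{\emptyset\ne S\subseteq\{1,\dots,k\}}\big]$ with $m_1,\dots,m_k$ now indeterminates, let $$R_N=B_k[e_1(m,x),\dots,e_N(m,x)]\subseteq B_k[x_1,\dots,x_k],$$ and let $N_k$ be the first $N\ge 0$ such that $R_N=R_{N+1}=R_{N+2}=\cdots$. **Theorem.** For $k=1,2,3$, $$\max\{N_k(P)\mid P\in\mathbb{N}^k\}=\max\{N_k(P)\mid P\in(\mathbb{C}^k)^\circ\}=N_k=2^k-1 .$$ Moreover, $N_4((1,2,4,8))=15$. -/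

import Mathlib

namespace IncidenceStrata

open AlgebraicGeometry CategoryTheory

noncomputable section

/-- The space `(ℂ^k)°` of admissible weights: no nonempty subset of the weights sums to zero. -/
def admissible (k : ℕ) : Set (Fin k → ℂ) :=
  {m | ∀ S : Finset (Fin k), S.Nonempty → ∑ i ∈ S, m i ≠ 0}

/-- The weighted elementary symmetric polynomial
`e_n(y, x) = ∑_{i_1 + ⋯ + i_k = n} (y_1 choose i_1) ⋯ (y_k choose i_k) x_1^{i_1} ⋯ x_k^{i_k}`
in the variables `x_1, …, x_k`, with weights `y_1, …, y_k` in a ring `B` that has binomial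
coefficients `(y choose i) = y (y - 1) ⋯ (y - i + 1) / i!`.  Up to the sign `(-1)^n` it is the
coefficient of `z^{y_1 + ⋯ + y_k - n}` in `(z - x_1)^{y_1} ⋯ (z - x_k)^{y_k}`. -/
def weightedEsymm {B : Type} [CommRing B] [BinomialRing B] {k : ℕ} (y : Fin k → B) (n : ℕ) :
    MvPolynomial (Fin k) B :=
  ∑ i ∈ (Finset.univ : Finset (Fin k)).piAntidiag n,
    MvPolynomial.C (∏ j, Ring.choose (y j) (i j)) * ∏ j, MvPolynomial.X j ^ i j

/-- The `ℂ`-algebra `ℂ[e_1(P, x), e_2(P, x), …] ⊆ ℂ[x_1, …, x_k]`. -/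
def stratumRing {k : ℕ} (P : Fin k → ℂ) : Subalgebra ℂ (MvPolynomial (Fin k) ℂ) :=
  Algebra.adjoin ℂ {f | ∃ j : ℕ, 1 ≤ j ∧ f = weightedEsymm P j}

/-- The incidence stratum `Δ^k_P(𝔸¹)` with weights `P`, as a scheme over `Spec ℂ`: the spectrum of
the algebra generated by the coefficients of `(z - x_1)^{m_1} ⋯ (z - x_k)^{m_k}`.  If the `m_i` are
positive integers with sum `d`, then `e_j(P, x) = 0` for `j > d`, and this is the (closed, reduced)
image of the map `𝔸^k → 𝔸^d`, `x ↦` coefficients of `∏ (z - x_i)^{m_i}`. -/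
def incidenceStratum {k : ℕ} (P : Fin k → ℂ) : Over (Spec (CommRingCat.of ℂ)) :=
  Over.mk (Spec.map (CommRingCat.ofHom (algebraMap ℂ (stratumRing P))))

/-- The scheme `X` over `ℂ` embeds into `𝔸^n`: there is a closed immersion `X ⟶ 𝔸^n` over `ℂ`. -/
def EmbedsInAffineSpace (X : Over (Spec (CommRingCat.of ℂ))) (n : ℕ) : Prop :=
  ∃ f : X ⟶ Over.mk (𝔸(Fin n; Spec (CommRingCat.of ℂ)) ↘ Spec (CommRingCat.of ℂ)),
    IsClosedImmersion f.left

/-- `N_k(P)`, the least `n` such that `Δ^k_P(𝔸¹)` embeds into `𝔸^n` (`⊤` if there is none). -/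
def embDim {k : ℕ} (P : Fin k → ℂ) : ℕ∞ :=
  ⨅ (n : ℕ) (_ : EmbedsInAffineSpace (incidenceStratum P) n), (n : ℕ∞)

/-- The submonoid of `ℂ[m_1, …, m_k]` generated by the sums `∑_{i ∈ S} m_i` over all nonempty
`S ⊆ {1, …, k}`. -/
def partialSums (k : ℕ) : Submonoid (MvPolynomial (Fin k) ℂ) :=
  Submonoid.closure
    {f | ∃ S : Finset (Fin k), S.Nonempty ∧ f = ∑ i ∈ S, MvPolynomial.X i}

/-- The ring `ℂ[m_1, …, m_k][{1 / ∑_{i ∈ S} m_i}_S]` of functions on `(ℂ^k)°`. -/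
abbrev WeightRing (k : ℕ) : Type := Localization (partialSums k)

/-- The tautological weights `m_1, …, m_k`. -/
def genericWeight (k : ℕ) : Fin k → WeightRing k :=
  fun i => algebraMap (MvPolynomial (Fin k) ℂ) (WeightRing k) (MvPolynomial.X i)

/-- The algebra
`R_N = ℂ[m_1, …, m_k][{1 / ∑_{i ∈ S} m_i}_S][e_1(m, x), …, e_N(m, x)]`. -/
def familyRing (k N : ℕ) : Subalgebra (WeightRing k) (MvPolynomial (Fin k) (WeightRing k)) :=
  Algebra.adjoin (WeightRing k)
    {f | ∃ j : ℕ, 1 ≤ j ∧ j ≤ N ∧ f = weightedEsymm (genericWeight k) j}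

/-- `N_k`, the first `N` with `R_N = R_{N+1} = R_{N+2} = ⋯` (`⊤` if there is none). -/
def uniformDim (k : ℕ) : ℕ∞ :=
  ⨅ (N : ℕ) (_ : ∀ i, N ≤ i → familyRing k i = familyRing k N), (N : ℕ∞)

end

end IncidenceStrata

/-!
By Newton's identities the algebra generated by the coefficients `e_1, …, e_N` equals the algebra
generated by the weighted power sums `p_n = ∑ m_i x_i ^ n`, `1 ≤ n ≤ N`
(`forall_weightedEsymm_mem_iff`), and an embedding of the stratum into `𝔸^N` is the same as a system
of `N` generators of its coordinate ring (`embedsInAffineSpace_incidenceStratum_iff`). So everything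
is a statement about the number of generators of the algebra of power sums.

*Upper bound for `k ≤ 3`.* The power sums of the points `x_i - p_1 / ∑ m_j`, whose centre of mass is
`0`, are polynomials in those of the `x_i` of at most the same degree. The shifted points then
satisfy one common monic equation of degree `D = 2 ^ k - 1` whose coefficients are polynomials in
their power sums `p_2, …, p_D`, the denominators being products of partial sums of the weights
(`cubic_of_center_eq_zero`, `septic_of_center_eq_zero`; for `k = 1` the equation is `x = 0`). A
common monic equation is a linear recurrence for the power sums, so all of them are polynomials in
`p_1, …, p_D` (`weightedPsum_mem_of_le_three`). This works over any ring in which the partial sums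
are invertible, in particular over `ℂ` and over the ring of functions on the space of admissible
weights. For `k = 4` and the weights `1, 2, 4, 8` the bound `15` is the degree of the polynomial
`∏ (z - x_i) ^ m_i`.

*Lower bound.* It is attained at the weights `1, 2, …, 2 ^ (k - 1)`, for `k ≤ 4`. The number of
generators is at least the dimension of the cotangent space at the origin, so it suffices to find a
point derivation at the origin that singles out `p_n`, for each `n ≤ 2 ^ k - 1`
(`le_card_of_adjoin_eq`). It exists as soon as `p_n` is not a combination of the products of power
sums of lower degree with total degree `n`, which can be tested by evaluation at finitely many
points (`exists_pointDerivation`). For `n ≥ 4` the points are taken on the locus `p_1 = p_2 = 0`,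
which for `k = 4` is a conic with points over `ℤ[√-14]`; there only the products of power sums of
degree at least `3` survive, one for each partition of `n` into parts `≥ 3`, and there are at most
`17` of these. The square matrix of their values is invertible because it is so modulo a prime above
`23` (`notMem_decomposableSpan_of_inverse`, `exists_points_notMem_decomposableSpan`). Finally, if
fewer coefficients generated the algebra over the space of admissible weights, then specialization
would contradict the bound for the weights `1, 2, …, 2 ^ (k - 1)`.
-/

namespace IncidenceStrata

/-! ### Embeddings into affine space and generators -/

section Embeddings

open AlgebraicGeometry CategoryTheory

theorem surjective_of_isClosedImmersion_specMap {R S : CommRingCat} (ψ : R ⟶ S)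
    [IsClosedImmersion (Spec.map ψ)] : Function.Surjective ψ := by
  intro a
  obtain ⟨y, hy⟩ := (IsClosedImmersion.isAffine_surjective_of_isAffine (f := Spec.map ψ)).2
    ((Scheme.ΓSpecIso S).inv a)
  refine ⟨(Scheme.ΓSpecIso R).hom y, ?_⟩
  rw [← CommRingCat.comp_apply, ← Scheme.ΓSpecIso_naturality, CommRingCat.comp_apply, hy,
    ← CommRingCat.comp_apply, Iso.inv_hom_id, CommRingCat.id_apply]

/-- Closed immersions of an affine `ℂ`-scheme `Spec A` into `𝔸^n` are the same as surjections of
`ℂ`-algebras from the polynomial ring in `n` variables onto `A`. -/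
theorem embedsInAffineSpace_spec_iff {A : Type} [CommRing A] [Algebra ℂ A] (n : ℕ) :
    EmbedsInAffineSpace (Over.mk (Spec.map (CommRingCat.ofHom (algebraMap ℂ A)))) n ↔
      ∃ φ : MvPolynomial (Fin n) ℂ →ₐ[ℂ] A, Function.Surjective φ := by
  constructor
  · rintro ⟨f, hf⟩
    have hw := Over.w f
    simp only [Over.mk_left, Over.mk_hom] at hw
    obtain ⟨ψ, hψ⟩ := Spec.map_surjective
      (f.left ≫ (AffineSpace.SpecIso (Fin n) (CommRingCat.of ℂ)).hom)
    have hgc : IsClosedImmersion (Spec.map ψ) := by rw [hψ]; infer_instance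
    have hcomp : CommRingCat.ofHom MvPolynomial.C ≫ ψ = CommRingCat.ofHom (algebraMap ℂ A) := by
      apply Spec.map_injective
      rw [Spec.map_comp, hψ, ← AffineSpace.SpecIso_inv_over (n := Fin n) (CommRingCat.of ℂ),
        Category.assoc, Iso.hom_inv_id_assoc]
      exact hw
    refine ⟨{ ψ.hom with commutes' := fun r => ?_ }, surjective_of_isClosedImmersion_specMap ψ⟩
    exact congrArg (fun g : CommRingCat.of ℂ ⟶ CommRingCat.of A => g.hom r) hcomp
  · rintro ⟨φ, hφ⟩
    have hci : IsClosedImmersion (Spec.map (CommRingCat.ofHom φ.toRingHom)) :=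
      IsClosedImmersion.spec_of_surjective _ hφ
    refine ⟨Over.homMk (Spec.map (CommRingCat.ofHom φ.toRingHom) ≫
      (AffineSpace.SpecIso (Fin n) (CommRingCat.of ℂ)).inv) ?_, ?_⟩
    · simp only [Over.mk_left, Over.mk_hom, Category.assoc]
      rw [AffineSpace.SpecIso_inv_over, ← Spec.map_comp, ← CommRingCat.ofHom_comp]
      congr 2
      ext r
      exact φ.commutes r
    · simp only [Over.homMk_left]
      infer_instance

theorem embedsInAffineSpace_incidenceStratum_iff {k : ℕ} (P : Fin k → ℂ) (n : ℕ) :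
    EmbedsInAffineSpace (incidenceStratum P) n ↔
      ∃ g : Fin n → MvPolynomial (Fin k) ℂ, stratumRing P = Algebra.adjoin ℂ (Set.range g) := by
  rw [incidenceStratum, embedsInAffineSpace_spec_iff]
  constructor
  · rintro ⟨φ, hφ⟩
    refine ⟨fun i => (φ (MvPolynomial.X i) : MvPolynomial (Fin k) ℂ), ?_⟩
    have h := (AlgHom.range_comp φ (stratumRing P).val)
    rw [(AlgHom.range_eq_top φ).mpr hφ] at h
    rw [Algebra.map_top, Subalgebra.range_val] at h
    refine h.symm.trans ?_
    rw [Algebra.adjoin_range_eq_range_aeval]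
    congr 1
    ext i
    simp
  · rintro ⟨g, hg⟩
    have hmem : ∀ i, g i ∈ stratumRing P := fun i => hg ▸ Algebra.subset_adjoin ⟨i, rfl⟩
    refine ⟨MvPolynomial.aeval fun i => ⟨g i, hmem i⟩, ?_⟩
    rintro ⟨a, ha⟩
    have ha' := ha
    rw [hg, Algebra.adjoin_range_eq_range_aeval] at ha'
    obtain ⟨q, hq⟩ := ha'
    refine ⟨q, Subtype.ext ?_⟩
    change (stratumRing P).val _ = a
    rw [← hq, ← AlgHom.comp_apply, MvPolynomial.comp_aeval]
    rfl

end Embeddings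

/-! ### Newton's identities -/

section PowerSums

open MvPolynomial

/-- The weighted power sum `p_n = ∑ y_i x_i ^ n`. -/
noncomputable def weightedPsum {B : Type} [CommRing B] {k : ℕ} (y : Fin k → B) (n : ℕ) :
    MvPolynomial (Fin k) B :=
  ∑ i, C (y i) * X i ^ n

section Newton

variable {B : Type} [CommRing B] [BinomialRing B] {k : ℕ} (y : Fin k → B)

theorem succ_mul_choose_succ (r : B) (n : ℕ) :
    ((n : B) + 1) * Ring.choose r (n + 1) = (r - n) * Ring.choose r n := by
  have h := Ring.choose_smul_choose r (Nat.le_succ n)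
  rw [Nat.succ_eq_add_one, Nat.choose_succ_self_right, Nat.add_sub_cancel_left,
    Ring.choose_one_right, nsmul_eq_mul] at h
  push_cast at h
  rw [h, mul_comm]

/-- The binomial series `(1 + x_i t) ^ y_i` in the variable `t`. -/
noncomputable def binomialFactor (i : Fin k) : PowerSeries (MvPolynomial (Fin k) B) :=
  PowerSeries.mk fun n => C (Ring.choose (y i) n) * X i ^ n

/-- The logarithmic derivative `y_i x_i / (1 + x_i t)` of `(1 + x_i t) ^ y_i`. -/
noncomputable def logDerivFactor (i : Fin k) : PowerSeries (MvPolynomial (Fin k) B) :=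
  PowerSeries.mk fun n => (-1) ^ n * (C (y i) * X i ^ (n + 1))

theorem weightedEsymm_eq_coeff (n : ℕ) :
    weightedEsymm y n = PowerSeries.coeff n (∏ i, binomialFactor y i) := by
  rw [PowerSeries.coeff_prod, weightedEsymm]
  symm
  refine Finset.sum_equiv Finsupp.equivFunOnFinite (fun l => ?_) (fun l _ => ?_)
  · simp [Finset.mem_finsuppAntidiag]
  · simp [binomialFactor, Finset.prod_mul_distrib]

theorem derivative_binomialFactor (i : Fin k) :
    PowerSeries.derivative (MvPolynomial (Fin k) B) (binomialFactor y i) =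
      logDerivFactor y i * binomialFactor y i := by
  have hu : IsUnit (1 + PowerSeries.C (X i : MvPolynomial (Fin k) B) * PowerSeries.X) := by
    rw [PowerSeries.isUnit_iff_constantCoeff]
    simp
  have hG : (1 + PowerSeries.C (X i : MvPolynomial (Fin k) B) * PowerSeries.X) *
      logDerivFactor y i = PowerSeries.C (C (y i) * X i) := by
    ext1 n
    rw [add_mul, one_mul, mul_assoc, map_add, PowerSeries.coeff_C_mul]
    cases n with
    | zero => simp [logDerivFactor]
    | succ n =>
      rw [PowerSeries.coeff_succ_X_mul, PowerSeries.coeff_C, if_neg n.succ_ne_zero]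
      simp only [logDerivFactor, PowerSeries.coeff_mk]
      ring
  apply hu.mul_left_cancel
  rw [← mul_assoc, hG]
  ext1 n
  rw [add_mul, one_mul, mul_assoc, map_add, PowerSeries.coeff_C_mul, PowerSeries.coeff_C_mul,
    PowerSeries.coeff_derivative]
  cases n with
  | zero =>
    simp [binomialFactor]
  | succ n =>
    have h := congrArg (C (σ := Fin k)) (succ_mul_choose_succ (y i) (n + 1))
    simp only [map_mul, map_add, map_sub, map_natCast, map_one, Nat.cast_succ] at h
    rw [PowerSeries.coeff_succ_X_mul, PowerSeries.coeff_derivative]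
    simp only [binomialFactor, PowerSeries.coeff_mk, Nat.cast_succ]
    linear_combination X i ^ (n + 2) * h

theorem derivative_prod_binomialFactor (s : Finset (Fin k)) :
    PowerSeries.derivative (MvPolynomial (Fin k) B) (∏ i ∈ s, binomialFactor y i) =
      (∑ i ∈ s, logDerivFactor y i) * ∏ i ∈ s, binomialFactor y i := by
  induction s using Finset.induction_on with
  | empty => simp
  | insert i s hi ih =>
    rw [Finset.prod_insert hi, Finset.sum_insert hi, Derivation.leibniz, ih,
      derivative_binomialFactor]
    simp only [smul_eq_mul]
    ring

/-- Newton's identities for the weighted symmetric polynomials. -/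
theorem succ_mul_weightedEsymm_succ (n : ℕ) :
    ((n : MvPolynomial (Fin k) B) + 1) * weightedEsymm y (n + 1) =
      ∑ ij ∈ Finset.HasAntidiagonal.antidiagonal n,
        (-1) ^ ij.1 * weightedPsum y (ij.1 + 1) * weightedEsymm y ij.2 := by
  have h := congrArg (PowerSeries.coeff n) (derivative_prod_binomialFactor y Finset.univ)
  rw [PowerSeries.coeff_derivative, PowerSeries.coeff_mul, ← weightedEsymm_eq_coeff] at h
  rw [mul_comm, h]
  refine Finset.sum_congr rfl fun ij _ => ?_
  rw [← weightedEsymm_eq_coeff]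
  simp [logDerivFactor, weightedPsum, Finset.mul_sum]

theorem weightedEsymm_zero : weightedEsymm y 0 = 1 := by
  simp [weightedEsymm]

/-- By Newton's identities, the first `N` coefficients and the first `N` power sums generate
the same algebra. -/
theorem forall_weightedEsymm_mem_iff [Algebra ℚ B] (S : Subalgebra B (MvPolynomial (Fin k) B))
    (N : ℕ) : (∀ j, 1 ≤ j → j ≤ N → weightedEsymm y j ∈ S) ↔
      ∀ j, 1 ≤ j → j ≤ N → weightedPsum y j ∈ S := by
  induction N with
  | zero => exact ⟨fun _ j h1 h2 => by omega, fun _ j h1 h2 => by omega⟩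
  | succ N ih =>
    have key : (∀ j, 1 ≤ j → j ≤ N → weightedEsymm y j ∈ S) →
        (weightedEsymm y (N + 1) ∈ S ↔ weightedPsum y (N + 1) ∈ S) := by
      intro he
      have he' : ∀ j ≤ N, weightedEsymm y j ∈ S := fun j hj => by
        rcases Nat.eq_zero_or_pos j with rfl | h
        · rw [weightedEsymm_zero]; exact S.one_mem
        · exact he j h hj
      have hp := ih.1 he
      have hN := succ_mul_weightedEsymm_succ y N
      have hsplit : ∑ ij ∈ Finset.HasAntidiagonal.antidiagonal N,
            (-1) ^ ij.1 * weightedPsum y (ij.1 + 1) * weightedEsymm y ij.2 =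
          (-1) ^ N * weightedPsum y (N + 1) +
            ∑ ij ∈ (Finset.HasAntidiagonal.antidiagonal N).erase (N, 0),
              (-1) ^ ij.1 * weightedPsum y (ij.1 + 1) * weightedEsymm y ij.2 := by
        rw [← Finset.add_sum_erase _ _ (by simp : (N, 0) ∈ Finset.HasAntidiagonal.antidiagonal N),
          weightedEsymm_zero, mul_one]
      have hrest : ∑ ij ∈ (Finset.HasAntidiagonal.antidiagonal N).erase (N, 0),
              (-1) ^ ij.1 * weightedPsum y (ij.1 + 1) * weightedEsymm y ij.2 ∈ S := by
        refine S.sum_mem fun ij hij => ?_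
        rw [Finset.mem_erase, Finset.HasAntidiagonal.mem_antidiagonal, Ne, Prod.ext_iff] at hij
        refine S.mul_mem (S.mul_mem ?_ (hp _ (by omega) ?_)) (he' _ (by omega))
        · exact S.pow_mem (S.neg_mem S.one_mem) _
        · by_contra hlt
          exact hij.1 ⟨by omega, by simp; omega⟩
      rw [hsplit] at hN
      constructor
      · intro h
        have h1 : weightedPsum y (N + 1) = (-1) ^ N *
            (((N : MvPolynomial (Fin k) B) + 1) * weightedEsymm y (N + 1) -
              ∑ ij ∈ (Finset.HasAntidiagonal.antidiagonal N).erase (N, 0),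
                (-1) ^ ij.1 * weightedPsum y (ij.1 + 1) * weightedEsymm y ij.2) := by
          rw [hN, add_sub_cancel_right, ← mul_assoc, ← mul_pow]
          simp
        rw [h1]
        exact S.mul_mem (S.pow_mem (S.neg_mem S.one_mem) _) (S.sub_mem (S.mul_mem
          (S.add_mem (S.natCast_mem N) S.one_mem) h) hrest)
      · intro h
        have h1 : weightedEsymm y (N + 1) = algebraMap B _ (algebraMap ℚ B ((N : ℚ) + 1)⁻¹) *
            (((N : MvPolynomial (Fin k) B) + 1) * weightedEsymm y (N + 1)) := by
          have hc : ((N : MvPolynomial (Fin k) B) + 1) =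
              algebraMap B _ (algebraMap ℚ B ((N : ℚ) + 1)) := by simp
          rw [hc, ← mul_assoc, ← map_mul, ← map_mul, inv_mul_cancel₀ (by positivity)]
          simp
        rw [h1, hN]
        exact S.mul_mem (S.algebraMap_mem _) (S.add_mem (S.mul_mem
          (S.pow_mem (S.neg_mem S.one_mem) _) h) hrest)
    constructor
    · intro he j h1 h2
      have he' := fun j h1 h2 => he j h1 (Nat.le_succ_of_le h2)
      rcases Nat.le_succ_iff.1 h2 with h | rfl
      · exact ih.1 he' j h1 h
      · exact (key he').1 (he _ h1 le_rfl)
    · intro hp j h1 h2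
      have hp' := fun j h1 h2 => hp j h1 (Nat.le_succ_of_le h2)
      rcases Nat.le_succ_iff.1 h2 with h | rfl
      · exact ih.2 hp' j h1 h
      · exact (key (ih.2 hp')).2 (hp _ h1 le_rfl)

end Newton

end PowerSums

/-! ### The upper bound for at most three points -/

section Recurrence

variable {B R : Type*} [CommRing B] [CommRing R] [Algebra B R] {ι : Type*} [Fintype ι]

/-- If finitely many elements satisfy a common monic equation of degree `D` over a subalgebra,
their weighted power sums satisfy a linear recurrence of length `D` over that subalgebra. -/
theorem sum_mul_pow_mem_of_monic_equation (A : Subalgebra B R) (w y : ι → R) {D : ℕ}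
    (a : Fin D → R) (ha : ∀ j, a j ∈ A) (hy : ∀ i, y i ^ D = ∑ j, a j * y i ^ (j : ℕ))
    (h0 : ∀ j < D, ∑ i, w i * y i ^ j ∈ A) (n : ℕ) : ∑ i, w i * y i ^ n ∈ A := by
  induction n using Nat.strong_induction_on with
  | _ n ih =>
    rcases lt_or_ge n D with h | h
    · exact h0 n h
    · obtain ⟨n, rfl⟩ := Nat.exists_eq_add_of_le h
      have hrec : ∑ i, w i * y i ^ (D + n) = ∑ j, a j * ∑ i, w i * y i ^ (j + n : ℕ) := by
        simp_rw [Finset.mul_sum]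
        rw [Finset.sum_comm]
        refine Finset.sum_congr rfl fun i _ => ?_
        rw [pow_add, hy, Finset.sum_mul, Finset.mul_sum]
        refine Finset.sum_congr rfl fun j _ => ?_
        ring
      rw [hrec]
      exact A.sum_mem fun j _ => A.mul_mem (ha j) (ih _ (by omega))

/-- Weighted power sums of translated points are polynomials in the power sums of the points. -/
theorem sum_mul_add_pow_mem (A : Subalgebra B R) (w y : ι → R) {c : R} (hc : c ∈ A) {n : ℕ}
    (h : ∀ j ≤ n, ∑ i, w i * y i ^ j ∈ A) : ∑ i, w i * (y i + c) ^ n ∈ A := by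
  have hexp : ∑ i, w i * (y i + c) ^ n =
      ∑ j ∈ Finset.range (n + 1), (∑ i, w i * y i ^ j) * (c ^ (n - j) * (n.choose j : R)) := by
    simp_rw [add_pow, Finset.mul_sum, Finset.sum_mul]
    rw [Finset.sum_comm]
    refine Finset.sum_congr rfl fun j _ => Finset.sum_congr rfl fun i _ => ?_
    ring
  rw [hexp]
  refine A.sum_mem fun j hj => A.mul_mem (h j ?_) (A.mul_mem (A.pow_mem hc _) (A.natCast_mem _))
  exact Nat.lt_succ_iff.1 (Finset.mem_range.1 hj)

end Recurrence

section MonicEquations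

variable {R : Type*} [CommRing R]

/-- The common equation of degree `3` of two points with centre of mass `0`. -/
theorem cubic_of_center_eq_zero {m₁ m₂ x₁ x₂ p₂ p₃ : R}
    (h : m₁ * x₁ + m₂ * x₂ = 0)
    (hp₂ : p₂ = m₁ * x₁ ^ 2 + m₂ * x₂ ^ 2) (hp₃ : p₃ = m₁ * x₁ ^ 3 + m₂ * x₂ ^ 3) (hu : IsUnit m₂) :
    m₁ * m₂ * (m₁ + m₂) * x₁ ^ 3 =
      m₁ * m₂ * p₃ + (m₁ ^ 2 - m₁ * m₂ + m₂ ^ 2) * p₂ * x₁ := by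
  obtain ⟨a, rfl⟩ : ∃ a, x₁ = m₂ * a := hu.dvd
  obtain rfl : x₂ = -(m₁ * a) := hu.mul_left_cancel (by linear_combination h)
  subst hp₂ hp₃
  ring

/-- The common equation of degree `7` of three points with centre of mass `0`: it is monic up to
the product of all partial sums of the weights, its other coefficients are polynomials in the
weighted power sums `p₂, …, p₇`, and it is symmetric under permutations of the three points.
Here `e₁, e₂, e₃` are the elementary symmetric polynomials of the weights, so that
`e₁ * e₂ - e₃` is the product of the three sums of two weights. -/
theorem septic_of_center_eq_zero
    {m₁ m₂ m₃ x₁ x₂ x₃ e₁ e₂ e₃ p₂ p₃ p₄ p₅ p₆ p₇ : R}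
    (h : m₁ * x₁ + m₂ * x₂ + m₃ * x₃ = 0)
    (he₁ : e₁ = m₁ + m₂ + m₃) (he₂ : e₂ = m₁ * m₂ + m₁ * m₃ + m₂ * m₃) (he₃ : e₃ = m₁ * m₂ * m₃)
    (hp₂ : p₂ = m₁ * x₁ ^ 2 + m₂ * x₂ ^ 2 + m₃ * x₃ ^ 2)
    (hp₃ : p₃ = m₁ * x₁ ^ 3 + m₂ * x₂ ^ 3 + m₃ * x₃ ^ 3)
    (hp₄ : p₄ = m₁ * x₁ ^ 4 + m₂ * x₂ ^ 4 + m₃ * x₃ ^ 4)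
    (hp₅ : p₅ = m₁ * x₁ ^ 5 + m₂ * x₂ ^ 5 + m₃ * x₃ ^ 5)
    (hp₆ : p₆ = m₁ * x₁ ^ 6 + m₂ * x₂ ^ 6 + m₃ * x₃ ^ 6)
    (hp₇ : p₇ = m₁ * x₁ ^ 7 + m₂ * x₂ ^ 7 + m₃ * x₃ ^ 7) (hu : IsUnit m₃) :
    e₁ * (e₁ * e₂ - e₃) * e₃ * x₁ ^ 7 =
      (e₃ * (e₁ * e₂ - e₃) * p₇ + e₃ * (-3 * e₁ ^ 2 + 6 * e₂) * p₅ * p₂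
        + (-e₁ * e₂ ^ 2 + 3 * e₁ ^ 2 * e₃ - 2 * e₂ * e₃) * p₄ * p₃
        + (e₁ ^ 2 * e₂ - 3 * e₂ ^ 2 + 2 * e₁ * e₃) * p₃ * p₂ ^ 2)
      + (e₃ * (e₁ ^ 3 - 3 * e₁ * e₂ + 7 * e₃) * p₆
        + (-e₁ ^ 3 * e₂ + 3 * e₁ * e₂ ^ 2 + 7 * e₁ ^ 2 * e₃ - 24 * e₂ * e₃) * p₄ * p₂
        + e₃ * (-3 * e₁ ^ 2 + 8 * e₂) * p₃ ^ 2
        + (e₁ ^ 4 - 6 * e₁ ^ 2 * e₂ + 9 * e₂ ^ 2 + e₁ * e₃) * p₂ ^ 3) * x₁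
      + (e₃ * ((3 * e₁ * e₂ - 21 * e₃) * p₅ + (-9 * e₁ ^ 2 + 24 * e₂) * p₃ * p₂)) * x₁ ^ 2
      + ((e₁ ^ 2 * e₂ ^ 2 - 3 * e₁ ^ 3 * e₃ - 3 * e₁ * e₂ * e₃ + 35 * e₃ ^ 2) * p₄
        + (-e₁ ^ 3 * e₂ + 3 * e₁ * e₂ ^ 2 + 7 * e₁ ^ 2 * e₃ - 24 * e₂ * e₃) * p₂ ^ 2) * x₁ ^ 3
      + (e₃ * (5 * e₁ * e₂ - 35 * e₃) * p₃) * x₁ ^ 4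
      + (e₃ * (3 * e₁ ^ 3 - 9 * e₁ * e₂ + 21 * e₃) * p₂) * x₁ ^ 5 := by
  -- Writing `x₁ = m₃ a`, `x₂ = m₃ b` turns the relation between the points into a parametrization,
  -- and the claim into a polynomial identity in `m₁, m₂, m₃, a, b`.
  obtain ⟨a, rfl⟩ : ∃ a, x₁ = m₃ * a := hu.dvd
  obtain ⟨b, rfl⟩ : ∃ b, x₂ = m₃ * b := hu.dvd
  obtain rfl : x₃ = -(m₁ * a + m₂ * b) := hu.mul_left_cancel (by linear_combination h)
  subst he₁ he₂ he₃ hp₂ hp₃ hp₄ hp₅ hp₆ hp₇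
  ring

end MonicEquations

section CommonEquation

variable {B R : Type*} [CommRing B] [CommRing R] [Algebra B R]

/-- A single point with centre of mass `0` is `0`. -/
theorem exists_common_equation_one (A : Subalgebra B R) {m : Fin 1 → B}
    (hm : ∀ S : Finset (Fin 1), S.Nonempty → IsUnit (∑ i ∈ S, m i)) {y : Fin 1 → R}
    (hc : ∑ i, algebraMap B R (m i) * y i = 0) :
    ∃ a : Fin 1 → R, (∀ j, a j ∈ A) ∧ ∀ i, y i ^ 1 = ∑ j, a j * y i ^ (j : ℕ) := by
  have hu : IsUnit (m 0) := by simpa using hm {0} (by simp)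
  refine ⟨0, fun _ => A.zero_mem, fun i => ?_⟩
  have h0 : y 0 = 0 := (hu.map (algebraMap B R)).mul_left_cancel (by simpa using hc)
  rw [Subsingleton.elim i 0, h0]
  simp

/-- `cubic_of_center_eq_zero` as a common monic equation of the two points. -/
theorem exists_common_equation_two (A : Subalgebra B R) {m : Fin 2 → B}
    (hm : ∀ S : Finset (Fin 2), S.Nonempty → IsUnit (∑ i ∈ S, m i)) {y : Fin 2 → R}
    (hc : ∑ i, algebraMap B R (m i) * y i = 0)
    (hp : ∀ j, 1 ≤ j → j ≤ 3 → ∑ i, algebraMap B R (m i) * y i ^ j ∈ A) :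
    ∃ a : Fin 3 → R, (∀ j, a j ∈ A) ∧ ∀ i, y i ^ 3 = ∑ j, a j * y i ^ (j : ℕ) := by
  have hu0 : IsUnit (algebraMap B R (m 0)) := by simpa using (hm {0} (by simp)).map (algebraMap B R)
  have hu1 : IsUnit (algebraMap B R (m 1)) := by simpa using (hm {1} (by simp)).map (algebraMap B R)
  have hu : IsUnit (m 0 * m 1 * (m 0 + m 1)) := by
    simpa using ((hm {0} (by simp)).mul (hm {1} (by simp))).mul (hm {0, 1} (by simp))
  obtain ⟨u, hu⟩ := hu.exists_left_inv
  replace hu := congrArg (algebraMap B R) hu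
  simp only [map_mul, map_add, map_one] at hu
  have hmA : ∀ i, algebraMap B R (m i) ∈ A := fun i => A.algebraMap_mem _
  have huA := A.algebraMap_mem u
  have h2 := hp 2 (by norm_num) (by norm_num)
  have h3 := hp 3 (by norm_num) (by norm_num)
  simp only [Fin.sum_univ_two] at hc h2 h3
  generalize algebraMap B R u = u at *
  generalize hm0 : algebraMap B R (m 0) = m₀ at *
  generalize hm1 : algebraMap B R (m 1) = m₁ at *
  have hA0 : m₀ ∈ A := hm0 ▸ hmA 0
  have hA1 : m₁ ∈ A := hm1 ▸ hmA 1
  generalize hp2 : m₀ * y 0 ^ 2 + m₁ * y 1 ^ 2 = p₂ at *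
  generalize hp3 : m₀ * y 0 ^ 3 + m₁ * y 1 ^ 3 = p₃ at *
  refine ⟨![u * (m₀ * m₁ * p₃), u * ((m₀ ^ 2 - m₀ * m₁ + m₁ ^ 2) * p₂), 0], ?_, ?_⟩
  · have e1 : u * (m₀ * m₁ * p₃) ∈ A := A.mul_mem huA (A.mul_mem (A.mul_mem hA0 hA1) h3)
    have e2 : u * ((m₀ ^ 2 - m₀ * m₁ + m₁ ^ 2) * p₂) ∈ A :=
      A.mul_mem huA (A.mul_mem (A.add_mem (A.sub_mem (A.pow_mem hA0 2) (A.mul_mem hA0 hA1))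
        (A.pow_mem hA1 2)) h2)
    intro j
    fin_cases j
    · exact e1
    · exact e2
    · exact A.zero_mem
  · have c0 := cubic_of_center_eq_zero hc hp2.symm hp3.symm hu1
    have c1 := cubic_of_center_eq_zero (m₁ := m₁) (m₂ := m₀) (x₁ := y 1) (x₂ := y 0)
      (p₂ := p₂) (p₃ := p₃) (by rw [← hc]; ring) (by rw [← hp2]; ring) (by rw [← hp3]; ring) hu0
    intro i
    fin_cases i
    · simp only [Fin.sum_univ_three, Fin.zero_eta, Matrix.cons_val, Fin.coe_ofNat_eq_mod]
      norm_num
      linear_combination u * c0 - y 0 ^ 3 * hu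
    · simp only [Fin.sum_univ_three, Fin.mk_one, Matrix.cons_val, Fin.coe_ofNat_eq_mod]
      norm_num
      linear_combination u * c1 - y 1 ^ 3 * hu

/-- `septic_of_center_eq_zero` as a common monic equation of the three points. -/
theorem exists_common_equation_three (A : Subalgebra B R) {m : Fin 3 → B}
    (hm : ∀ S : Finset (Fin 3), S.Nonempty → IsUnit (∑ i ∈ S, m i)) {y : Fin 3 → R}
    (hc : ∑ i, algebraMap B R (m i) * y i = 0)
    (hp : ∀ j, 1 ≤ j → j ≤ 7 → ∑ i, algebraMap B R (m i) * y i ^ j ∈ A) :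
    ∃ a : Fin 7 → R, (∀ j, a j ∈ A) ∧ ∀ i, y i ^ 7 = ∑ j, a j * y i ^ (j : ℕ) := by
  have hu0 : IsUnit (algebraMap B R (m 0)) := by simpa using (hm {0} (by simp)).map (algebraMap B R)
  have hu1 : IsUnit (algebraMap B R (m 1)) := by simpa using (hm {1} (by simp)).map (algebraMap B R)
  have hu2 : IsUnit (algebraMap B R (m 2)) := by simpa using (hm {2} (by simp)).map (algebraMap B R)
  obtain ⟨e₁, he₁⟩ : ∃ e, e = m 0 + m 1 + m 2 := ⟨_, rfl⟩
  obtain ⟨e₂, he₂⟩ : ∃ e, e = m 0 * m 1 + m 0 * m 2 + m 1 * m 2 := ⟨_, rfl⟩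
  obtain ⟨e₃, he₃⟩ : ∃ e, e = m 0 * m 1 * m 2 := ⟨_, rfl⟩
  have hu : IsUnit (e₁ * (e₁ * e₂ - e₃) * e₃) := by
    have h1 : IsUnit e₁ := by
      have := hm Finset.univ (by simp)
      rwa [Fin.sum_univ_three, ← he₁] at this
    have h2 : e₁ * e₂ - e₃ = (m 0 + m 1) * (m 0 + m 2) * (m 1 + m 2) := by
      rw [he₁, he₂, he₃]; ring
    have h3 : IsUnit e₃ := by
      rw [he₃]
      simpa using ((hm {0} (by simp)).mul (hm {1} (by simp))).mul (hm {2} (by simp))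
    refine (h1.mul ?_).mul h3
    rw [h2]
    simpa using ((hm {0, 1} (by simp)).mul (hm {0, 2} (by simp))).mul (hm {1, 2} (by simp))
  obtain ⟨u, hu⟩ := hu.exists_left_inv
  replace hu := congrArg (algebraMap B R) hu
  replace he₁ := congrArg (algebraMap B R) he₁
  replace he₂ := congrArg (algebraMap B R) he₂
  replace he₃ := congrArg (algebraMap B R) he₃
  simp only [map_mul, map_add, map_sub, map_one] at hu he₁ he₂ he₃
  have hlift : ∀ b : B, ∃ v : A, (v : R) = algebraMap B R b := fun b =>
    ⟨⟨_, A.algebraMap_mem b⟩, rfl⟩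
  have hliftp : ∀ j, 1 ≤ j → j ≤ 7 → ∃ v : A, (v : R) = algebraMap B R (m 0) * y 0 ^ j +
      algebraMap B R (m 1) * y 1 ^ j + algebraMap B R (m 2) * y 2 ^ j := fun j h1 h2 =>
    ⟨⟨_, hp j h1 h2⟩, Fin.sum_univ_three fun i => algebraMap B R (m i) * y i ^ j⟩
  obtain ⟨U, hU⟩ := hlift u
  obtain ⟨E₁, hE₁⟩ := hlift e₁
  obtain ⟨E₂, hE₂⟩ := hlift e₂
  obtain ⟨E₃, hE₃⟩ := hlift e₃
  obtain ⟨P₂, hP₂⟩ := hliftp 2 (by norm_num) (by norm_num)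
  obtain ⟨P₃, hP₃⟩ := hliftp 3 (by norm_num) (by norm_num)
  obtain ⟨P₄, hP₄⟩ := hliftp 4 (by norm_num) (by norm_num)
  obtain ⟨P₅, hP₅⟩ := hliftp 5 (by norm_num) (by norm_num)
  obtain ⟨P₆, hP₆⟩ := hliftp 6 (by norm_num) (by norm_num)
  obtain ⟨P₇, hP₇⟩ := hliftp 7 (by norm_num) (by norm_num)
  rw [← hE₁] at hu he₁
  rw [← hE₂] at hu he₂
  rw [← hE₃, ← hU] at hu
  rw [← hE₃] at he₃
  rw [Fin.sum_univ_three] at hc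
  have c0 := septic_of_center_eq_zero (x₁ := y 0) (x₂ := y 1) (x₃ := y 2)
      hc he₁ he₂ he₃ hP₂ hP₃ hP₄ hP₅ hP₆ hP₇ hu2
  have c1 := septic_of_center_eq_zero (m₁ := algebraMap B R (m 1))
      (m₂ := algebraMap B R (m 0)) (m₃ := algebraMap B R (m 2)) (x₁ := y 1) (x₂ := y 0) (x₃ := y 2)
      (by rw [← hc]; ring) (he₁.trans (by ring)) (he₂.trans (by ring)) (he₃.trans (by ring))
      (hP₂.trans (by ring)) (hP₃.trans (by ring)) (hP₄.trans (by ring))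
      (hP₅.trans (by ring)) (hP₆.trans (by ring)) (hP₇.trans (by ring)) hu2
  have c2 := septic_of_center_eq_zero (m₁ := algebraMap B R (m 2))
      (m₂ := algebraMap B R (m 1)) (m₃ := algebraMap B R (m 0)) (x₁ := y 2) (x₂ := y 1) (x₃ := y 0)
      (by rw [← hc]; ring) (he₁.trans (by ring)) (he₂.trans (by ring)) (he₃.trans (by ring))
      (hP₂.trans (by ring)) (hP₃.trans (by ring)) (hP₄.trans (by ring))
      (hP₅.trans (by ring)) (hP₆.trans (by ring)) (hP₇.trans (by ring)) hu0
  -- The coefficients are formed inside `A`, so that they need no membership proofs.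
  let a : Fin 7 → A :=
    ![U * (E₃ * (E₁ * E₂ - E₃) * P₇ + E₃ * (-3 * E₁ ^ 2 + 6 * E₂) * P₅ * P₂
        + (-E₁ * E₂ ^ 2 + 3 * E₁ ^ 2 * E₃ - 2 * E₂ * E₃) * P₄ * P₃
        + (E₁ ^ 2 * E₂ - 3 * E₂ ^ 2 + 2 * E₁ * E₃) * P₃ * P₂ ^ 2),
      U * (E₃ * (E₁ ^ 3 - 3 * E₁ * E₂ + 7 * E₃) * P₆
        + (-E₁ ^ 3 * E₂ + 3 * E₁ * E₂ ^ 2 + 7 * E₁ ^ 2 * E₃ - 24 * E₂ * E₃) * P₄ * P₂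
        + E₃ * (-3 * E₁ ^ 2 + 8 * E₂) * P₃ ^ 2
        + (E₁ ^ 4 - 6 * E₁ ^ 2 * E₂ + 9 * E₂ ^ 2 + E₁ * E₃) * P₂ ^ 3),
      U * (E₃ * ((3 * E₁ * E₂ - 21 * E₃) * P₅ + (-9 * E₁ ^ 2 + 24 * E₂) * P₃ * P₂)),
      U * ((E₁ ^ 2 * E₂ ^ 2 - 3 * E₁ ^ 3 * E₃ - 3 * E₁ * E₂ * E₃ + 35 * E₃ ^ 2) * P₄
        + (-E₁ ^ 3 * E₂ + 3 * E₁ * E₂ ^ 2 + 7 * E₁ ^ 2 * E₃ - 24 * E₂ * E₃) * P₂ ^ 2),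
      U * (E₃ * (5 * E₁ * E₂ - 35 * E₃) * P₃),
      U * (E₃ * (3 * E₁ ^ 3 - 9 * E₁ * E₂ + 21 * E₃) * P₂), 0]
  refine ⟨fun j => a j, fun j => (a j).2, fun i => ?_⟩
  have hsum : ∀ z : R, ∑ j, (a j : R) * z ^ (j : ℕ) = a 0 + a 1 * z + a 2 * z ^ 2 + a 3 * z ^ 3 +
      a 4 * z ^ 4 + a 5 * z ^ 5 := fun z => by
    have h6 : a 6 = 0 := rfl
    simp [Fin.sum_univ_seven, h6]
  rw [hsum]
  have hnum : ∀ (n : ℕ) [n.AtLeastTwo], ((ofNat(n) : A) : R) = ofNat(n) :=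
    fun _ _ => rfl
  simp only [a, Matrix.cons_val]
  push_cast
  simp only [hnum]
  fin_cases i
  · simp only [Fin.zero_eta]
    linear_combination (U : R) * c0 - y 0 ^ 7 * hu
  · simp only [Fin.mk_one]
    linear_combination (U : R) * c1 - y 1 ^ 7 * hu
  · simp only [Fin.reduceFinMk]
    linear_combination (U : R) * c2 - y 2 ^ 7 * hu

end CommonEquation

/-- For `k ≤ 3` and weights with invertible partial sums, all weighted power sums are polynomials
in the first `2 ^ k - 1` of them. -/
theorem weightedPsum_mem_of_le_three {B : Type} [CommRing B] {k : ℕ} (h1 : 1 ≤ k) (h3 : k ≤ 3)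
    {m : Fin k → B} (hm : ∀ S : Finset (Fin k), S.Nonempty → IsUnit (∑ i ∈ S, m i))
    (A : Subalgebra B (MvPolynomial (Fin k) B))
    (hp : ∀ j, 1 ≤ j → j ≤ 2 ^ k - 1 → weightedPsum m j ∈ A) (n : ℕ) : weightedPsum m n ∈ A := by
  have hp0 : ∀ j ≤ 2 ^ k - 1,
      ∑ i, algebraMap B (MvPolynomial (Fin k) B) (m i) * MvPolynomial.X i ^ j ∈ A := by
    intro j hj
    rcases Nat.eq_zero_or_pos j with rfl | h
    · simp only [pow_zero, mul_one]
      exact A.sum_mem fun i _ => A.algebraMap_mem _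
    · exact hp j h hj
  have : NeZero k := ⟨by omega⟩
  -- `c` is the centre of mass, and `y` are the points translated so that it becomes `0`.
  obtain ⟨u, hu⟩ := (hm Finset.univ Finset.univ_nonempty).exists_left_inv
  set c : MvPolynomial (Fin k) B := algebraMap B _ u * weightedPsum m 1 with hc
  have h2k : 1 ≤ 2 ^ k - 1 := Nat.le_sub_one_of_lt (Nat.one_lt_two_pow (by omega))
  have hcA : c ∈ A := A.mul_mem (A.algebraMap_mem u) (hp 1 le_rfl h2k)
  set y : Fin k → MvPolynomial (Fin k) B := fun i => MvPolynomial.X i + -c with hy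
  have hyA : ∀ j ≤ 2 ^ k - 1, ∑ i, algebraMap B (MvPolynomial (Fin k) B) (m i) * y i ^ j ∈ A :=
    fun j hj => sum_mul_add_pow_mem A _ _ (A.neg_mem hcA) fun l hl => hp0 l (hl.trans hj)
  have hcenter : ∑ i, algebraMap B (MvPolynomial (Fin k) B) (m i) * y i = 0 := by
    have hu' := congrArg (algebraMap B (MvPolynomial (Fin k) B)) hu
    rw [map_mul, map_sum, map_one] at hu'
    have hw : weightedPsum m 1 = ∑ i, algebraMap B (MvPolynomial (Fin k) B) (m i) *
        MvPolynomial.X i := by simp [weightedPsum, MvPolynomial.algebraMap_eq]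
    simp only [hy, mul_add, Finset.sum_add_distrib, ← Finset.sum_mul]
    rw [← hw, hc]
    linear_combination -weightedPsum m 1 * hu'
  obtain ⟨a, ha, hya⟩ : ∃ a : Fin (2 ^ k - 1) → MvPolynomial (Fin k) B, (∀ j, a j ∈ A) ∧
      ∀ i, y i ^ (2 ^ k - 1) = ∑ j, a j * y i ^ (j : ℕ) := by
    have hyA' := fun j (_ : 1 ≤ j) (h : j ≤ 2 ^ k - 1) => hyA j h
    interval_cases k
    · exact exists_common_equation_one A hm hcenter
    · exact exists_common_equation_two A hm hcenter hyA'
    · exact exists_common_equation_three A hm hcenter hyA'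
  have hall := sum_mul_pow_mem_of_monic_equation A
    (fun i => algebraMap B (MvPolynomial (Fin k) B) (m i)) y a ha hya fun j hj => hyA j hj.le
  have h := sum_mul_add_pow_mem (n := n) A _ _ hcA fun j _ => hall j
  simpa [hy, weightedPsum, MvPolynomial.algebraMap_eq] using h

/-! ### Point derivations at the origin -/

section PointDerivations

variable {V : Type*} [CommRing V] [Algebra ℂ V]

/-- The span of all products `v_{j_1} ⋯ v_{j_l}` of total weight `j_1 + ⋯ + j_l = n`, with
positive indices. -/
def productSpan (v : ℕ → V) (n : ℕ) : Submodule ℂ V :=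
  Submodule.span ℂ {w | ∃ s : Multiset ℕ, 0 ∉ s ∧ s.sum = n ∧ w = (s.map v).prod}

/-- The span of all products `v_{j_1} ⋯ v_{j_l}` of total weight `n` with positive indices,
`v_n` itself being excluded. -/
def decomposableSpan (v : ℕ → V) (n : ℕ) : Submodule ℂ V :=
  Submodule.span ℂ {w | ∃ s : Multiset ℕ, 0 ∉ s ∧ n ∉ s ∧ s.sum = n ∧ w = (s.map v).prod}

theorem mul_mem_productSpan {v : ℕ → V} {i j : ℕ} {a b : V} (ha : a ∈ productSpan v i)
    (hb : b ∈ productSpan v j) : a * b ∈ productSpan v (i + j) := by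
  have h := Submodule.mul_mem_mul ha hb
  rw [productSpan, productSpan, Submodule.span_mul_span] at h
  refine Submodule.span_mono ?_ h
  rintro _ ⟨_, ⟨s, hs, rfl, rfl⟩, _, ⟨t, ht, rfl, rfl⟩, rfl⟩
  exact ⟨s + t, by simp [hs, ht], by simp, by simp⟩

theorem mul_mem_decomposableSpan {v : ℕ → V} {i j : ℕ} (hi : 0 < i) (hj : 0 < j) {a b : V}
    (ha : a ∈ productSpan v i) (hb : b ∈ productSpan v j) :
    a * b ∈ decomposableSpan v (i + j) := by
  have h := Submodule.mul_mem_mul ha hb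
  rw [productSpan, productSpan, Submodule.span_mul_span] at h
  refine Submodule.span_mono ?_ h
  rintro _ ⟨_, ⟨s, hs, rfl, rfl⟩, _, ⟨t, ht, rfl, rfl⟩, rfl⟩
  refine ⟨s + t, by simp [hs, ht], fun hmem => ?_, by simp, by simp⟩
  rcases Multiset.mem_add.1 hmem with h | h
  · have := Multiset.le_sum_of_mem h
    omega
  · have := Multiset.le_sum_of_mem h
    omega

variable {k : ℕ} (P : Fin k → ℂ)

/-- The algebra generated by the weighted power sums of positive degree. -/
noncomputable def psumAlgebra : Subalgebra ℂ (MvPolynomial (Fin k) ℂ) :=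
  Algebra.adjoin ℂ {f | ∃ j : ℕ, 1 ≤ j ∧ f = weightedPsum P j}

/-- The values of the weighted power sum `p_j` at a family of points. -/
def psumValues {r : ℕ} (a : Fin r → Fin k → ℂ) (j : ℕ) : Fin r → ℂ :=
  fun s => ∑ i, P i * a s i ^ j

/-- Evaluation at the points `t • a_s` with a formal parameter `t`, simultaneously for all `s`. -/
noncomputable def lineEval {r : ℕ} (a : Fin r → Fin k → ℂ) :
    MvPolynomial (Fin k) ℂ →ₐ[ℂ] Polynomial (Fin r → ℂ) :=
  MvPolynomial.aeval fun i => Polynomial.monomial 1 fun s => a s i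

theorem lineEval_weightedPsum {r : ℕ} (a : Fin r → Fin k → ℂ) (j : ℕ) :
    lineEval a (weightedPsum P j) = Polynomial.monomial j (psumValues P a j) := by
  have h : ∀ i, lineEval a (MvPolynomial.C (P i) * MvPolynomial.X i ^ j) =
      Polynomial.monomial j fun s => P i * a s i ^ j := by
    intro i
    rw [map_mul, map_pow, ← MvPolynomial.algebraMap_eq, AlgHom.commutes, lineEval,
      MvPolynomial.aeval_X, Polynomial.monomial_pow, Polynomial.algebraMap_apply,
      Polynomial.C_mul_monomial, one_mul]
    rfl
  rw [weightedPsum, map_sum, Finset.sum_congr rfl fun i _ => h i, ← map_sum]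
  congr 1
  ext s
  simp [psumValues]

theorem coeff_zero_lineEval {r : ℕ} (a : Fin r → Fin k → ℂ) (f : MvPolynomial (Fin k) ℂ) :
    (lineEval a f).coeff 0 = algebraMap ℂ (Fin r → ℂ) (MvPolynomial.constantCoeff f) := by
  induction f using MvPolynomial.induction_on with
  | C c =>
    rw [← MvPolynomial.algebraMap_eq, AlgHom.commutes, Polynomial.algebraMap_apply]
    simp
  | add f g hf hg => rw [map_add, Polynomial.coeff_add, hf, hg, map_add, map_add]
  | mul_X f i hf =>
    rw [map_mul, Polynomial.mul_coeff_zero, map_mul]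
    simp [lineEval]

/-- The coefficient of `t ^ n` of an element of the algebra of power sums involves only products of
weight `n`. -/
theorem coeff_lineEval_mem {r : ℕ} (a : Fin r → Fin k → ℂ) {f : MvPolynomial (Fin k) ℂ}
    (hf : f ∈ psumAlgebra P) (n : ℕ) :
    (lineEval a f).coeff n ∈ productSpan (psumValues P a) n := by
  induction hf using Algebra.adjoin_induction generalizing n with
  | mem f hf =>
    obtain ⟨j, hj, rfl⟩ := hf
    rw [lineEval_weightedPsum, Polynomial.coeff_monomial]
    split_ifs with h
    · subst h
      exact Submodule.subset_span ⟨{j}, by simp; omega, by simp, by simp⟩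
    · exact Submodule.zero_mem _
  | algebraMap c =>
    rw [AlgHom.commutes, Polynomial.algebraMap_apply, Polynomial.coeff_C]
    split_ifs with h
    · subst h
      rw [Algebra.algebraMap_eq_smul_one]
      exact Submodule.smul_mem _ _ (Submodule.subset_span ⟨0, by simp, by simp, by simp⟩)
    · exact Submodule.zero_mem _
  | add f g _ _ hf hg =>
    rw [map_add, Polynomial.coeff_add]
    exact Submodule.add_mem _ (hf n) (hg n)
  | mul f g _ _ hf hg =>
    rw [map_mul, Polynomial.coeff_mul]
    refine Submodule.sum_mem _ fun ij hij => ?_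
    rw [← Finset.HasAntidiagonal.mem_antidiagonal.1 hij]
    exact mul_mem_productSpan (hf _) (hg _)

/-- If the value vector of `p_n` at some points is not a combination of the value vectors of the
other products of weight `n`, then the algebra of power sums has a point derivation at the origin
that singles out `p_n`. -/
theorem exists_pointDerivation {r n : ℕ} (hn : 1 ≤ n) (a : Fin r → Fin k → ℂ)
    (ha : psumValues P a n ∉ decomposableSpan (psumValues P a) n) :
    ∃ D : MvPolynomial (Fin k) ℂ →ₗ[ℂ] ℂ,
      (∀ f ∈ psumAlgebra P, ∀ g ∈ psumAlgebra P, D (f * g) =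
        MvPolynomial.constantCoeff f * D g + MvPolynomial.constantCoeff g * D f) ∧
      (∀ c, D (algebraMap ℂ _ c) = 0) ∧
      ∀ j, D (weightedPsum P j) = if j = n then 1 else 0 := by
  obtain ⟨φ, hφ, hker⟩ := Submodule.exists_le_ker_of_notMem ha
  refine ⟨(φ (psumValues P a n))⁻¹ • (φ ∘ₗ (Polynomial.lcoeff (Fin r → ℂ) n).restrictScalars ℂ ∘ₗ
    (lineEval a).toLinearMap), ?_, ?_, ?_⟩
  · intro f hf g hg
    -- The coefficient of `t ^ n` of a product, up to its two extreme terms, is decomposable.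
    have hsum : ((lineEval a f) * (lineEval a g)).coeff n -
        (MvPolynomial.constantCoeff f • (lineEval a g).coeff n +
          MvPolynomial.constantCoeff g • (lineEval a f).coeff n) ∈
        decomposableSpan (psumValues P a) n := by
      obtain ⟨n, rfl⟩ := Nat.exists_eq_add_of_le' hn
      rw [Polynomial.coeff_mul, Finset.Nat.sum_antidiagonal_succ, Algebra.smul_def,
        Algebra.smul_def, ← coeff_zero_lineEval a f, ← coeff_zero_lineEval a g]
      rcases n with _ | n
      · simp [mul_comm]
      · rw [Finset.Nat.sum_antidiagonal_succ']
        have hrest : ∑ p ∈ Finset.HasAntidiagonal.antidiagonal n,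
            (lineEval a f).coeff (p.1 + 1) * (lineEval a g).coeff (p.2 + 1) ∈
            decomposableSpan (psumValues P a) (n + 1 + 1) := by
          refine Submodule.sum_mem _ fun p hp => ?_
          have hp' := Finset.HasAntidiagonal.mem_antidiagonal.1 hp
          have := mul_mem_decomposableSpan (Nat.succ_pos _) (Nat.succ_pos _)
            (coeff_lineEval_mem P a hf (p.1 + 1)) (coeff_lineEval_mem P a hg (p.2 + 1))
          rwa [show p.1 + 1 + (p.2 + 1) = n + 1 + 1 by omega] at this
        convert hrest using 1
        ring
    have := hker hsum
    rw [LinearMap.mem_ker, map_sub, map_add, map_smul, map_smul, sub_eq_zero] at this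
    simp only [LinearMap.smul_apply, LinearMap.comp_apply, AlgHom.toLinearMap_apply,
      LinearMap.restrictScalars_apply, Polynomial.lcoeff_apply, map_mul, this, smul_eq_mul]
    ring
  · intro c
    simp only [LinearMap.smul_apply, LinearMap.comp_apply, AlgHom.toLinearMap_apply,
      LinearMap.restrictScalars_apply, Polynomial.lcoeff_apply, AlgHom.commutes,
      Polynomial.algebraMap_apply, Polynomial.coeff_C, if_neg (by omega : n ≠ 0), map_zero,
      smul_zero]
  · intro j
    simp only [LinearMap.smul_apply, LinearMap.comp_apply, AlgHom.toLinearMap_apply,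
      LinearMap.restrictScalars_apply, Polynomial.lcoeff_apply, lineEval_weightedPsum,
      Polynomial.coeff_monomial]
    split_ifs with h
    · subst h
      exact inv_mul_cancel₀ hφ
    · simp

/-- The cotangent space at the origin bounds the number of generators from below. -/
theorem le_card_of_adjoin_eq {d N : ℕ} (g : Fin N → MvPolynomial (Fin k) ℂ)
    (hg : psumAlgebra P = Algebra.adjoin ℂ (Set.range g))
    (hD : ∀ n, 1 ≤ n → n ≤ d → ∃ (r : ℕ) (a : Fin r → Fin k → ℂ),
      psumValues P a n ∉ decomposableSpan (psumValues P a) n) : d ≤ N := by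
  choose r a ha using hD
  have hex := fun n : Fin d => exists_pointDerivation P (by omega) (a (n + 1) (by omega) (by omega))
    (ha (n + 1) (by omega) (by omega))
  choose D hmul hconst hp using hex
  set L : MvPolynomial (Fin k) ℂ →ₗ[ℂ] (Fin d → ℂ) := LinearMap.pi D with hL
  have hle : ∀ f ∈ psumAlgebra P, L f ∈ Submodule.span ℂ (Set.range (L ∘ g)) := by
    intro f hf
    have hsub : ∀ f, f ∈ Algebra.adjoin ℂ (Set.range g) → f ∈ psumAlgebra P := fun f h => hg ▸ h
    rw [hg] at hf
    induction hf using Algebra.adjoin_induction with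
    | mem f hf =>
      obtain ⟨i, rfl⟩ := hf
      exact Submodule.subset_span ⟨i, rfl⟩
    | algebraMap c =>
      have : L (algebraMap ℂ _ c) = 0 := funext fun n => hconst n c
      rw [this]
      exact Submodule.zero_mem _
    | add f g _ _ hf hg =>
      rw [map_add]
      exact Submodule.add_mem _ hf hg
    | mul f f' h h' hf hf' =>
      have : L (f * f') = MvPolynomial.constantCoeff f • L f' +
          MvPolynomial.constantCoeff f' • L f :=
        funext fun n => hmul n f (hsub f h) f' (hsub f' h')
      rw [this]
      exact Submodule.add_mem _ (Submodule.smul_mem _ _ hf') (Submodule.smul_mem _ _ hf)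
  have htop : Submodule.span ℂ (Set.range (L ∘ g)) = ⊤ := by
    rw [eq_top_iff, ← (Pi.basisFun ℂ (Fin d)).span_eq, Submodule.span_le]
    rintro _ ⟨n, rfl⟩
    have : Pi.basisFun ℂ (Fin d) n = L (weightedPsum P (n + 1)) := by
      ext i
      rw [Pi.basisFun_apply, hL, LinearMap.pi_apply, hp, Pi.single_apply]
      simp [Fin.ext_iff, eq_comm]
    rw [this]
    exact hle _ (Algebra.subset_adjoin ⟨n + 1, by omega, rfl⟩)
  have hfin := finrank_range_le_card (R := ℂ) (L ∘ g)
  rw [Set.finrank, htop, finrank_top] at hfin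
  simpa using hfin

end PointDerivations

/-! ### Independence of products of power sums at special points -/

section Partitions

/-- The nondecreasing lists of integers `≥ j` with sum `n`. The first argument bounds the depth of
the recursion, each step of which either removes a part `j` or increases `j`. -/
def partitionsGE : ℕ → ℕ → ℕ → List (List ℕ)
  | 0, _, n => if n = 0 then [[]] else []
  | f + 1, j, n =>
    if n = 0 then [[]] else if n < j then [] else
      (partitionsGE f j (n - j)).map (j :: ·) ++ partitionsGE f (j + 1) n

theorem exists_mem_partitionsGE (f j n : ℕ) (hj : 1 ≤ j) (hf : n + (n + 1 - j) ≤ f)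
    (s : Multiset ℕ) (hs : ∀ a ∈ s, j ≤ a) (hsum : s.sum = n) :
    ∃ l ∈ partitionsGE f j n, (l : Multiset ℕ) = s := by
  induction f generalizing j n s with
  | zero =>
    obtain rfl : n = 0 := by omega
    have h0 : s = 0 := Multiset.eq_zero_of_forall_notMem fun a ha => by
      have h1 := Multiset.le_sum_of_mem ha
      have h2 := hs a ha
      omega
    exact ⟨[], by simp [partitionsGE], by simp [h0]⟩
  | succ f ih =>
    rw [partitionsGE]
    split_ifs with h0 hlt
    · have h0 : s = 0 := Multiset.eq_zero_of_forall_notMem fun a ha => by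
        have h1 := Multiset.le_sum_of_mem ha
        have h2 := hs a ha
        omega
      exact ⟨[], by simp, by simp [h0]⟩
    · obtain ⟨a, ha⟩ : ∃ a, a ∈ s :=
        Multiset.exists_mem_of_ne_zero (by rintro rfl; simp at hsum; omega)
      have h1 := Multiset.le_sum_of_mem ha
      have h2 := hs a ha
      omega
    · by_cases hmem : j ∈ s
      · obtain ⟨t, rfl⟩ := Multiset.exists_cons_of_mem hmem
        rw [Multiset.sum_cons] at hsum
        obtain ⟨l, hl, rfl⟩ := ih j (n - j) hj (by omega) t
          (fun a ha => hs a (Multiset.mem_cons_of_mem ha)) (by omega)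
        exact ⟨j :: l, List.mem_append_left _ (List.mem_map_of_mem hl), rfl⟩
      · obtain ⟨l, hl, rfl⟩ := ih (j + 1) n (by omega) (by omega) s
          (fun a ha => lt_of_le_of_ne (hs a ha) (by rintro rfl; exact hmem ha)) hsum
        exact ⟨l, List.mem_append_right _ hl, rfl⟩

end Partitions

section Certificates

theorem decomposableSpan_congr {V : Type*} [CommRing V] [Algebra ℂ V] {v w : ℕ → V}
    (h : ∀ j, 1 ≤ j → v j = w j) (n : ℕ) : decomposableSpan v n = decomposableSpan w n := by
  have hmap : ∀ s : Multiset ℕ, 0 ∉ s → s.map v = s.map w := fun s hs =>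
    Multiset.map_congr rfl fun j hj => h j (Nat.pos_of_ne_zero fun h0 => hs (h0 ▸ hj))
  rw [decomposableSpan, decomposableSpan]
  congr 1
  ext x
  constructor
  · rintro ⟨s, h0, hn, hs, rfl⟩
    exact ⟨s, h0, hn, hs, by rw [hmap s h0]⟩
  · rintro ⟨s, h0, hn, hs, rfl⟩
    exact ⟨s, h0, hn, hs, by rw [hmap s h0]⟩

/-- The power sum `x_1 ^ j + 2 x_2 ^ j + 4 x_3 ^ j + 8 x_4 ^ j` with weights `1, 2, 4, 8`. -/
def binaryPsum {R : Type*} [CommRing R] (x : Fin 4 → R) (j : ℕ) : R :=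
  x 0 ^ j + 2 * x 1 ^ j + 4 * x 2 ^ j + 8 * x 3 ^ j

theorem map_binaryPsum {R S : Type*} [CommRing R] [CommRing S] (f : R →+* S) (x : Fin 4 → R)
    (j : ℕ) : f (binaryPsum x j) = binaryPsum (f ∘ x) j := by
  simp [binaryPsum, map_ofNat]

/-- The embedding `ℤ[√-14] → ℂ`. -/
noncomputable def toComplex : ℤ√(-14) →+* ℂ :=
  Zsqrtd.lift ⟨Real.sqrt 14 * Complex.I, by
    have h : ((Real.sqrt 14 : ℝ) : ℂ) * (Real.sqrt 14 : ℝ) = 14 := by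
      rw [← Complex.ofReal_mul, Real.mul_self_sqrt (by norm_num)]
      norm_num
    push_cast
    linear_combination (Complex.I * Complex.I) * h + 14 * Complex.I_mul_I⟩

theorem toComplex_injective : Function.Injective toComplex :=
  Zsqrtd.lift_injective _ fun n h => by nlinarith [mul_self_nonneg n]

/-- The reduction `ℤ[√-14] → 𝔽₂₃` with `√-14 ↦ 3`. -/
def modTwentyThree : ℤ√(-14) →+* ZMod 23 :=
  Zsqrtd.lift ⟨3, by decide⟩

/-- Criterion for `v_n` to be independent of the other products of weight `n`, at points of
`ℤ[√-14]⁴` where the power sums of degree `< c` vanish: the square matrix of the values of all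
products of power sums of degree `≥ c` is invertible modulo a prime ideal over `23`. -/
theorem notMem_decomposableSpan_of_inverse {r c n : ℕ} (a : Fin r → Fin 4 → ℤ√(-14))
    (hc : 1 ≤ c) (ha : ∀ s, ∀ j, 1 ≤ j → j < c → binaryPsum (a s) j = 0)
    (hr : (partitionsGE (2 * n) c n).length = r) (i₀ : Fin r)
    (hi₀ : (partitionsGE (2 * n) c n).getD i₀ [] = [n]) (K : Matrix (Fin r) (Fin r) (ZMod 23))
    (hK : Matrix.of (fun i s : Fin r => (((partitionsGE (2 * n) c n).getD i []).map
      fun j => binaryPsum (modTwentyThree ∘ a s) j).prod) * K = 1) :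
    (fun s => toComplex (binaryPsum (a s) n)) ∉
      decomposableSpan (fun j s => toComplex (binaryPsum (a s) j)) n := by
  -- `L` enumerates the partitions of `n` into parts `≥ c`.
  set L : Fin r → List ℕ := fun i => (partitionsGE (2 * n) c n).getD i [] with hLdef
  have hL : ∀ l ∈ partitionsGE (2 * n) c n, ∃ i, L i = l := by
    intro l hl
    obtain ⟨i, hi, rfl⟩ := List.mem_iff_getElem.1 hl
    exact ⟨⟨i, hr ▸ hi⟩, List.getD_eq_getElem _ _ hi⟩
  replace hi₀ : L i₀ = [n] := hi₀
  replace hK : Matrix.of (fun i s : Fin r => ((L i).map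
      fun j => binaryPsum (modTwentyThree ∘ a s) j).prod) * K = 1 := hK
  set v : ℕ → Fin r → ℂ := fun j s => toComplex (binaryPsum (a s) j) with hv
  set M : Matrix (Fin r) (Fin r) (ℤ√(-14)) :=
    Matrix.of fun i s => ((L i).map fun j => binaryPsum (a s) j).prod with hM
  have hred : (modTwentyThree.mapMatrix M).det ≠ 0 := by
    have hMK : modTwentyThree.mapMatrix M * K = 1 := by
      rw [← hK]
      congr 1
      ext i s
      simp only [hM, RingHom.mapMatrix_apply, Matrix.map_apply, Matrix.of_apply, map_list_prod,
        List.map_map, Function.comp_def, map_binaryPsum]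
    have hdet := congrArg Matrix.det hMK
    rw [Matrix.det_mul, Matrix.det_one] at hdet
    have : Fact (Nat.Prime 23) := ⟨by norm_num⟩
    exact left_ne_zero_of_mul (hdet.symm ▸ one_ne_zero)
  have hdet : (toComplex.mapMatrix M).det ≠ 0 := by
    rw [← RingHom.map_det] at hred ⊢
    intro h
    rw [(map_eq_zero_iff _ toComplex_injective).1 h, map_zero] at hred
    exact hred rfl
  have hrow : ∀ i, (toComplex.mapMatrix M).row i = ((L i).map v).prod := by
    intro i
    ext s
    have h := map_list_prod (Pi.evalRingHom (fun _ : Fin r => ℂ) s) ((L i).map v)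
    rw [List.map_map] at h
    refine Eq.trans ?_ h.symm
    simp only [hM, Matrix.row_apply, RingHom.mapMatrix_apply, Matrix.map_apply, Matrix.of_apply,
      map_list_prod, List.map_map]
    rfl
  have hind := Matrix.linearIndependent_rows_of_det_ne_zero hdet
  have hnot : (toComplex.mapMatrix M).row i₀ ∉
      Submodule.span ℂ ((toComplex.mapMatrix M).row '' {i₀}ᶜ) :=
    hind.notMem_span_image (by simp)
  rw [hrow, hi₀, List.map_singleton, List.prod_singleton] at hnot
  intro hmem
  refine hnot ?_
  have hle : decomposableSpan v n ≤
      Submodule.span ℂ ((toComplex.mapMatrix M).row '' {i₀}ᶜ) := by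
    rw [decomposableSpan, Submodule.span_le]
    rintro _ ⟨s, hs0, hsn, hsum, rfl⟩
    by_cases hsmall : ∃ j ∈ s, j < c
    · -- a factor of degree less than `c` vanishes at all the points
      obtain ⟨j, hj, hjc⟩ := hsmall
      have hj1 : 1 ≤ j := Nat.pos_of_ne_zero fun h => hs0 (h ▸ hj)
      have hvj : v j = 0 := by
        ext t
        simp [hv, ha t j hj1 hjc]
      rw [Multiset.prod_eq_zero (hvj ▸ Multiset.mem_map_of_mem v hj)]
      exact Submodule.zero_mem _
    · push Not at hsmall
      have hn : n + (n + 1 - c) ≤ 2 * n := by omega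
      obtain ⟨l, hl, rfl⟩ := exists_mem_partitionsGE (2 * n) c n hc hn s hsmall hsum
      obtain ⟨i, rfl⟩ := hL l hl
      refine Submodule.subset_span ⟨i, ?_, ?_⟩
      · rintro rfl
        exact hsn (by simp [hi₀])
      · rw [hrow]
        simp
  exact hle hmem

/-- The two points of the projective plane `x_4 = 0` where `p_1` and `p_2` vanish. -/
def planePoint (s : ℤ) : Fin 4 → ℤ√(-14) :=
  ![⟨-4, 4 * s - 2⟩, ⟨-4, 1 - 2 * s⟩, ⟨3, 0⟩, 0]

/-- Points of projective space on the conic `p_1 = p_2 = 0`, parametrized by the lines through the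
first of the points with `x_4 = 0`. -/
def conicPoint (t : ℤ) : Fin 4 → ℤ√(-14) :=
  ![⟨-12 * t ^ 2 + 112, 6 * t ^ 2 + 48 * t + 56⟩, ⟨-12 * t ^ 2 - 96 * t - 144, -3 * t ^ 2 + 36⟩,
    ⟨9 * t ^ 2 + 48 * t + 108, 0⟩, ⟨-32, -(16 + 6 * t)⟩]

theorem binaryPsum_planePoint (s : Fin 2) (j : ℕ) (h1 : 1 ≤ j) (h3 : j < 3) :
    binaryPsum (planePoint (s : ℕ)) j = 0 := by
  interval_cases j <;> revert s <;> decide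

theorem binaryPsum_conicPoint (t : ℤ) (j : ℕ) (h1 : 1 ≤ j) (h3 : j < 3) :
    binaryPsum (conicPoint t) j = 0 := by
  have h2 : (2 : ℤ√(-14)) = ⟨2, 0⟩ := rfl
  have h4 : (4 : ℤ√(-14)) = ⟨4, 0⟩ := rfl
  have h8 : (8 : ℤ√(-14)) = ⟨8, 0⟩ := rfl
  interval_cases j
  · ext <;> simp [binaryPsum, conicPoint, h2, h4, h8] <;> ring
  · ext <;> simp [binaryPsum, conicPoint, h2, h4, h8, pow_two] <;> ring

/-- For every degree `n ≤ 15` there are points at which `p_n` is independent of the other products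
of weight `n`. The points lie in the coordinate subspace of the `x_i` of weight at most `n`, so
that they serve for the weights `1, 2, …, 2 ^ (k - 1)` as soon as `n < 2 ^ k`. -/
theorem exists_points_notMem_decomposableSpan (n : ℕ) (h1 : 1 ≤ n) (h15 : n ≤ 15) :
    ∃ (r : ℕ) (a : Fin r → Fin 4 → ℤ√(-14)), (∀ s (i : Fin 4), n < 2 ^ (i : ℕ) → a s i = 0) ∧
      (fun s => toComplex (binaryPsum (a s) n)) ∉
        decomposableSpan (fun j s => toComplex (binaryPsum (a s) j)) n := by
  have hplane : ∀ s : ℤ, ∀ i : Fin 4, 4 ≤ n → n < 2 ^ (i : ℕ) → planePoint s i = 0 := by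
    intro s i h4 hi
    fin_cases i
    · norm_num at hi; omega
    · norm_num at hi; omega
    · norm_num at hi; omega
    · rfl
  have hconic : ∀ t : ℤ, ∀ i : Fin 4, 8 ≤ n → n < 2 ^ (i : ℕ) → conicPoint t i = 0 := by
    intro t i h8 hi
    have : 2 ^ (i : ℕ) ≤ 2 ^ 3 := Nat.pow_le_pow_right (by norm_num) (by omega)
    omega
  -- The matrices below are the inverses modulo `23` of the matrices of values, whose rows are
  -- indexed by the partitions of `n` into parts `≥ c` and whose columns by the points.
  interval_cases n
  · refine ⟨1, fun _ => ![1, 0, 0, 0], by decide,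
      notMem_decomposableSpan_of_inverse (c := 1) _ (by norm_num)
        (fun s j h1 h2 => absurd h1 (by omega))
        (by decide +kernel) 0 (by decide +kernel)
        !![1]
        (by decide +kernel)⟩
  · refine ⟨1, fun _ => ![2, -1, 0, 0], by decide,
      notMem_decomposableSpan_of_inverse (c := 2) _ (by norm_num)
        (by
          intro s j h1 h2
          obtain rfl : j = 1 := by omega
          revert s
          decide)
        (by decide +kernel) 0 (by decide +kernel)
        !![4]
        (by decide +kernel)⟩
  · refine ⟨1, fun _ => ![2, -1, 0, 0], by decide,
      notMem_decomposableSpan_of_inverse (c := 2) _ (by norm_num)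
        (by
          intro s j h1 h2
          obtain rfl : j = 1 := by omega
          revert s
          decide)
        (by decide +kernel) 0 (by decide +kernel)
        !![4]
        (by decide +kernel)⟩
  · refine ⟨1, fun s => planePoint (s : ℕ), fun s i => hplane _ i (by norm_num),
      notMem_decomposableSpan_of_inverse (c := 3) _ (by norm_num)
        (fun s => binaryPsum_planePoint (Fin.castLE (by norm_num) s))
        (by decide +kernel) 0 (by decide +kernel)
        !![22]
        (by decide +kernel)⟩
  · refine ⟨1, fun s => planePoint (s : ℕ), fun s i => hplane _ i (by norm_num),
      notMem_decomposableSpan_of_inverse (c := 3) _ (by norm_num)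
        (fun s => binaryPsum_planePoint (Fin.castLE (by norm_num) s))
        (by decide +kernel) 0 (by decide +kernel)
        !![3]
        (by decide +kernel)⟩
  · refine ⟨2, fun s => planePoint (s : ℕ), fun s i => hplane _ i (by norm_num),
      notMem_decomposableSpan_of_inverse (c := 3) _ (by norm_num)
        (fun s => binaryPsum_planePoint (Fin.castLE (by norm_num) s))
        (by decide +kernel) 1 (by decide +kernel)
        !![2, 2; 3, 14]
        (by decide +kernel)⟩
  · refine ⟨2, fun s => planePoint (s : ℕ), fun s i => hplane _ i (by norm_num),
      notMem_decomposableSpan_of_inverse (c := 3) _ (by norm_num)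
        (fun s => binaryPsum_planePoint (Fin.castLE (by norm_num) s))
        (by decide +kernel) 1 (by decide +kernel)
        !![20, 1; 2, 5]
        (by decide +kernel)⟩
  · refine ⟨3, fun s => conicPoint (s : ℕ), fun s i => hconic _ i (by norm_num),
      notMem_decomposableSpan_of_inverse (c := 3) _ (by norm_num)
        (fun s => binaryPsum_conicPoint _)
        (by decide +kernel) 2 (by decide +kernel)
        !![7, 18, 1; 18, 4, 18; 16, 19, 17]
        (by decide +kernel)⟩
  · refine ⟨4, fun s => conicPoint (s : ℕ), fun s i => hconic _ i (by norm_num),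
      notMem_decomposableSpan_of_inverse (c := 3) _ (by norm_num)
        (fun s => binaryPsum_conicPoint _)
        (by decide +kernel) 3 (by decide +kernel)
        !![2, 4, 1, 10; 19, 3, 13, 10; 0, 19, 8, 4; 18, 5, 16, 7]
        (by decide +kernel)⟩
  · refine ⟨5, fun s => conicPoint (s : ℕ), fun s i => hconic _ i (by norm_num),
      notMem_decomposableSpan_of_inverse (c := 3) _ (by norm_num)
        (fun s => binaryPsum_conicPoint _)
        (by decide +kernel) 4 (by decide +kernel)
        !![18, 2, 16, 12, 17; 12, 2, 15, 16, 17; 19, 5, 18, 2, 8; 13, 6, 14, 1, 13; 13, 15, 19,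
          18, 12]
        (by decide +kernel)⟩
  · refine ⟨6, fun s => conicPoint (s : ℕ), fun s i => hconic _ i (by norm_num),
      notMem_decomposableSpan_of_inverse (c := 3) _ (by norm_num)
        (fun s => binaryPsum_conicPoint _)
        (by decide +kernel) 5 (by decide +kernel)
        !![11, 8, 3, 5, 13, 21; 12, 5, 11, 17, 13, 14; 10, 4, 16, 13, 7, 22; 2, 22, 10, 13, 18,
          1; 1, 8, 21, 19, 4, 6; 18, 2, 10, 21, 2, 10]
        (by decide +kernel)⟩
  · refine ⟨9, fun s => conicPoint (s : ℕ), fun s i => hconic _ i (by norm_num),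
      notMem_decomposableSpan_of_inverse (c := 3) _ (by norm_num)
        (fun s => binaryPsum_conicPoint _)
        (by decide +kernel) 8 (by decide +kernel)
        !![3, 9, 5, 20, 1, 6, 7, 11, 21; 13, 3, 11, 8, 14, 5, 8, 16, 22; 10, 6, 2, 2, 6, 6, 8, 3,
          3; 8, 20, 18, 20, 22, 21, 12, 20, 5; 17, 11, 4, 13, 2, 21, 9, 13, 6; 8, 3, 13, 17, 9,
          21, 2, 4, 9; 13, 14, 6, 19, 9, 21, 12, 7, 20; 19, 19, 8, 17, 7, 12, 4, 13, 7; 2, 16, 1,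
          4, 16, 8, 4, 5, 10]
        (by decide +kernel)⟩
  · refine ⟨10, fun s => conicPoint (s : ℕ), fun s i => hconic _ i (by norm_num),
      notMem_decomposableSpan_of_inverse (c := 3) _ (by norm_num)
        (fun s => binaryPsum_conicPoint _)
        (by decide +kernel) 9 (by decide +kernel)
        !![14, 22, 1, 0, 18, 19, 3, 19, 0, 9; 1, 8, 12, 22, 2, 5, 13, 21, 9, 4; 20, 2, 7, 9, 4,
          4, 12, 22, 19, 1; 13, 21, 22, 1, 22, 1, 21, 18, 16, 8; 3, 1, 10, 5, 7, 6, 13, 13, 7, 7;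
          8, 10, 22, 3, 18, 4, 6, 1, 10, 6; 15, 0, 3, 20, 3, 18, 0, 4, 10, 5; 17, 2, 12, 15, 8,
          0, 19, 16, 0, 16; 10, 18, 6, 4, 5, 13, 3, 1, 22, 0; 1, 12, 5, 12, 22, 5, 7, 14, 16, 12]
        (by decide +kernel)⟩
  · refine ⟨13, fun s => conicPoint (s : ℕ), fun s i => hconic _ i (by norm_num),
      notMem_decomposableSpan_of_inverse (c := 3) _ (by norm_num)
        (fun s => binaryPsum_conicPoint _)
        (by decide +kernel) 12 (by decide +kernel)
        !![17, 0, 4, 15, 8, 9, 22, 1, 5, 3, 11, 3, 4; 4, 15, 17, 14, 10, 9, 4, 4, 11, 19, 9, 4,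
          19; 15, 22, 5, 4, 6, 10, 21, 11, 22, 1, 9, 19, 9; 21, 16, 14, 15, 3, 10, 13, 5, 6, 15,
          9, 6, 2; 17, 10, 3, 13, 4, 8, 22, 16, 2, 20, 21, 5, 16; 3, 13, 10, 6, 0, 12, 3, 5, 15,
          11, 11, 22, 0; 11, 1, 4, 6, 3, 21, 12, 20, 13, 22, 20, 10, 11; 19, 9, 9, 8, 0, 5, 1,
          10, 5, 14, 9, 0, 11; 12, 14, 13, 5, 4, 5, 10, 10, 3, 8, 21, 22, 6; 22, 22, 17, 17, 16,
          19, 1, 20, 15, 4, 20, 12, 10; 7, 11, 0, 14, 1, 7, 10, 10, 17, 15, 2, 2, 6; 15, 21, 20,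
          18, 10, 19, 6, 9, 7, 7, 8, 5, 13; 14, 20, 22, 15, 1, 8, 1, 21, 22, 5, 17, 12, 20]
        (by decide +kernel)⟩
  · refine ⟨17, fun s => conicPoint (s : ℕ), fun s i => hconic _ i (by norm_num),
      notMem_decomposableSpan_of_inverse (c := 3) _ (by norm_num)
        (fun s => binaryPsum_conicPoint _)
        (by decide +kernel) 16 (by decide +kernel)
        !![3, 4, 6, 6, 5, 19, 10, 13, 8, 22, 17, 8, 0, 3, 16, 6, 9; 5, 8, 15, 13, 22, 0, 19, 4,
          7, 13, 7, 16, 13, 14, 2, 12, 11; 12, 13, 13, 10, 2, 19, 4, 1, 17, 0, 4, 12, 2, 1, 11,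
          6, 0; 6, 9, 18, 17, 14, 8, 18, 12, 1, 22, 15, 4, 6, 20, 7, 3, 3; 18, 16, 13, 16, 13,
          15, 16, 21, 21, 10, 22, 12, 4, 20, 21, 13, 3; 1, 0, 16, 4, 11, 16, 15, 0, 17, 18, 20,
          13, 14, 2, 11, 8, 9; 18, 13, 7, 14, 22, 1, 2, 7, 4, 8, 18, 5, 2, 10, 19, 5, 16; 18, 18,
          15, 19, 8, 0, 21, 0, 4, 22, 9, 19, 2, 3, 16, 22, 20; 10, 21, 3, 21, 19, 20, 20, 1, 21,
          3, 16, 14, 2, 0, 10, 15, 13; 19, 7, 4, 9, 9, 18, 12, 2, 7, 5, 5, 21, 7, 22, 6, 7, 21;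
          22, 10, 2, 15, 19, 5, 22, 20, 6, 21, 13, 8, 1, 19, 10, 10, 17; 0, 10, 7, 16, 22, 12,
          14, 14, 14, 1, 13, 2, 19, 1, 17, 18, 15; 10, 11, 19, 16, 12, 12, 15, 18, 1, 15, 8, 3,
          11, 15, 3, 20, 21; 4, 6, 0, 21, 13, 10, 16, 19, 2, 21, 9, 22, 7, 1, 1, 8, 5; 5, 4, 1,
          13, 17, 11, 2, 1, 3, 0, 0, 19, 14, 12, 5, 17, 17; 4, 4, 2, 5, 0, 21, 0, 21, 4, 17, 13,
          16, 6, 6, 6, 3, 1; 15, 3, 11, 11, 16, 3, 21, 2, 18, 14, 20, 22, 14, 3, 8, 8, 19]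
        (by decide +kernel)⟩

end Certificates

/-! ### The embedding dimensions -/

section StratumRing

variable {k : ℕ}

theorem stratumRing_eq_psumAlgebra (P : Fin k → ℂ) : stratumRing P = psumAlgebra P := by
  apply le_antisymm
  · refine Algebra.adjoin_le ?_
    rintro _ ⟨j, hj, rfl⟩
    exact (forall_weightedEsymm_mem_iff P (psumAlgebra P) j).2
      (fun i hi _ => Algebra.subset_adjoin ⟨i, hi, rfl⟩) j hj le_rfl
  · refine Algebra.adjoin_le ?_
    rintro _ ⟨j, hj, rfl⟩
    exact (forall_weightedEsymm_mem_iff P (stratumRing P) j).1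
      (fun i hi _ => Algebra.subset_adjoin ⟨i, hi, rfl⟩) j hj le_rfl

theorem embDim_le_of_adjoin_eq (P : Fin k → ℂ) {n : ℕ} (g : Fin n → MvPolynomial (Fin k) ℂ)
    (h : stratumRing P = Algebra.adjoin ℂ (Set.range g)) : embDim P ≤ n :=
  iInf₂_le n ((embedsInAffineSpace_incidenceStratum_iff P n).2 ⟨g, h⟩)

theorem embDim_le_of_admissible (h1 : 1 ≤ k) (h3 : k ≤ 3) {P : Fin k → ℂ}
    (hP : P ∈ admissible k) : embDim P ≤ (2 ^ k - 1 : ℕ) := by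
  refine embDim_le_of_adjoin_eq P (fun i => weightedPsum P (i + 1)) ?_
  rw [stratumRing_eq_psumAlgebra]
  apply le_antisymm
  · refine Algebra.adjoin_le ?_
    rintro _ ⟨j, -, rfl⟩
    refine weightedPsum_mem_of_le_three h1 h3 (fun S hS => (hP S hS).isUnit) _
      (fun j hj1 hj2 => ?_) j
    refine Algebra.subset_adjoin ⟨⟨j - 1, by omega⟩, ?_⟩
    simp only [Nat.sub_add_cancel hj1]
  · refine Algebra.adjoin_le ?_
    rintro _ ⟨i, rfl⟩
    exact Algebra.subset_adjoin ⟨i + 1, by omega, rfl⟩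

/-- For natural weights with sum `d`, the coefficients `e_n` with `n > d` vanish. -/
theorem weightedEsymm_natCast_eq_zero (m : Fin k → ℕ) {n : ℕ} (hn : ∑ i, m i < n) :
    weightedEsymm (fun i => (m i : ℂ)) n = 0 := by
  refine Finset.sum_eq_zero fun i hi => ?_
  have hsum : ∑ j, i j = n := (Finset.mem_piAntidiag.1 hi).1
  obtain ⟨j, -, hj⟩ := Finset.exists_lt_of_sum_lt (hsum ▸ hn)
  rw [Finset.prod_eq_zero (Finset.mem_univ j), map_zero, zero_mul]
  rw [Ring.choose_natCast, Nat.choose_eq_zero_of_lt hj, Nat.cast_zero]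

theorem embDim_natCast_le (m : Fin k → ℕ) : embDim (fun i => (m i : ℂ)) ≤ (∑ i, m i : ℕ) := by
  refine embDim_le_of_adjoin_eq _ (fun i => weightedEsymm (fun i => (m i : ℂ)) (i + 1)) ?_
  apply le_antisymm
  · refine Algebra.adjoin_le ?_
    rintro _ ⟨j, hj1, rfl⟩
    rcases le_or_gt j (∑ i, m i) with h | h
    · refine Algebra.subset_adjoin ⟨⟨j - 1, by omega⟩, ?_⟩
      simp only [Nat.sub_add_cancel hj1]
    · rw [weightedEsymm_natCast_eq_zero m h]
      exact Subalgebra.zero_mem _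
  · refine Algebra.adjoin_le ?_
    rintro _ ⟨i, rfl⟩
    exact Algebra.subset_adjoin ⟨i + 1, by omega, rfl⟩

theorem natCast_mem_admissible {m : Fin k → ℕ} (hm : ∀ i, 0 < m i) :
    (fun i => (m i : ℂ)) ∈ admissible k := by
  intro S hS
  rw [← Nat.cast_sum, Nat.cast_ne_zero]
  exact (Finset.sum_pos (fun i _ => hm i) hS).ne'

end StratumRing

section BinaryWeights

/-- The weights `1, 2, 4, …, 2 ^ (k - 1)`. -/
def binaryWeight (k : ℕ) : Fin k → ℕ := fun i => 2 ^ (i : ℕ)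

theorem psumValues_binaryWeight {k r : ℕ} (h4 : k ≤ 4) (a : Fin r → Fin 4 → ℤ√(-14))
    (ha : ∀ s (i : Fin 4), k ≤ i → a s i = 0) {j : ℕ} (hj : 1 ≤ j) :
    psumValues (fun i => (binaryWeight k i : ℂ)) (fun s i => toComplex (a s (Fin.castLE h4 i))) j =
      fun s => toComplex (binaryPsum (a s) j) := by
  ext s
  have h := ha s
  have hj0 : j ≠ 0 := by omega
  rw [map_binaryPsum]
  simp only [psumValues, binaryPsum, binaryWeight, Function.comp_apply, Nat.cast_pow,
    Nat.cast_ofNat]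
  have hz : ∀ i : Fin 4, k ≤ i → toComplex (a s i) ^ j = 0 := fun i hi => by
    rw [h i hi, map_zero, zero_pow hj0]
  have h0 := hz 0
  have h1 := hz 1
  have h2 := hz 2
  have h3 := hz 3
  interval_cases k
  · simp_all
  · simp_all
  · simp_all [Fin.sum_univ_succ]
  · simp_all [Fin.sum_univ_succ]

    ring
  · simp_all [Fin.sum_univ_succ]

    ring

/-- For the weights `1, 2, …, 2 ^ (k - 1)` with `k ≤ 4`, the algebra of power sums needs
`2 ^ k - 1` generators. -/
theorem two_pow_sub_one_le_of_adjoin_eq {k N : ℕ} (h4 : k ≤ 4)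
    (g : Fin N → MvPolynomial (Fin k) ℂ)
    (hg : psumAlgebra (fun i => (binaryWeight k i : ℂ)) = Algebra.adjoin ℂ (Set.range g)) :
    2 ^ k - 1 ≤ N := by
  refine le_card_of_adjoin_eq _ g hg fun n h1 hn => ?_
  have h2k : 2 ^ k ≤ 2 ^ 4 := Nat.pow_le_pow_right (by norm_num) h4
  obtain ⟨r, a, ha, hmem⟩ := exists_points_notMem_decomposableSpan n h1 (by omega)
  have ha' : ∀ s (i : Fin 4), k ≤ i → a s i = 0 := fun s i hi => ha s i (by
    have := Nat.pow_le_pow_right (n := 2) (by norm_num) hi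
    have := Nat.one_le_two_pow (n := k)
    omega)
  refine ⟨r, fun s i => toComplex (a s (Fin.castLE h4 i)), ?_⟩
  rw [psumValues_binaryWeight h4 a ha' h1,
    decomposableSpan_congr (fun j hj => psumValues_binaryWeight h4 a ha' hj)]
  exact hmem

theorem two_pow_sub_one_le_embDim {k : ℕ} (h4 : k ≤ 4) :
    ((2 ^ k - 1 : ℕ) : ℕ∞) ≤ embDim (fun i => (binaryWeight k i : ℂ)) := by
  refine le_iInf₂ fun n hn => ?_
  obtain ⟨g, hg⟩ := (embedsInAffineSpace_incidenceStratum_iff _ n).1 hn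
  rw [stratumRing_eq_psumAlgebra] at hg
  exact_mod_cast two_pow_sub_one_le_of_adjoin_eq h4 g hg

end BinaryWeights

section Family

variable {k : ℕ}

theorem isUnit_sum_genericWeight (S : Finset (Fin k)) (hS : S.Nonempty) :
    IsUnit (∑ i ∈ S, genericWeight k i) := by
  have h := IsLocalization.map_units (WeightRing k)
    (⟨∑ i ∈ S, MvPolynomial.X i, Submonoid.subset_closure ⟨S, hS, rfl⟩⟩ : partialSums k)
  simpa [genericWeight] using h

theorem familyRing_le_iff {N : ℕ}
    {A : Subalgebra (WeightRing k) (MvPolynomial (Fin k) (WeightRing k))} :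
    familyRing k N ≤ A ↔ ∀ j, 1 ≤ j → j ≤ N → weightedPsum (genericWeight k) j ∈ A := by
  rw [← forall_weightedEsymm_mem_iff, familyRing, Algebra.adjoin_le_iff]
  constructor
  · exact fun h j h1 hN => h ⟨j, h1, hN, rfl⟩
  · rintro h _ ⟨j, h1, hN, rfl⟩
    exact h j h1 hN

theorem familyRing_eq_of_le (h1 : 1 ≤ k) (h3 : k ≤ 3) {i : ℕ} (hi : 2 ^ k - 1 ≤ i) :
    familyRing k i = familyRing k (2 ^ k - 1) := by
  apply le_antisymm
  · exact familyRing_le_iff.2 fun j _ _ => weightedPsum_mem_of_le_three h1 h3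
      isUnit_sum_genericWeight _ (familyRing_le_iff.1 le_rfl) j
  · exact familyRing_le_iff.2 fun j hj1 hj2 => familyRing_le_iff.1 le_rfl j hj1 (hj2.trans hi)

theorem isUnit_eval_partialSums {P : Fin k → ℂ} (hP : P ∈ admissible k) (f : partialSums k) :
    IsUnit (MvPolynomial.eval P (f : MvPolynomial (Fin k) ℂ)) := by
  suffices h : partialSums k ≤ (IsUnit.submonoid ℂ).comap (MvPolynomial.eval P) from h f.2
  refine Submonoid.closure_le.2 ?_
  rintro _ ⟨S, hS, rfl⟩
  simpa [IsUnit.mem_submonoid_iff] using hP S hS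

/-- Specialization of the functions on the space of admissible weights at an admissible weight. -/
noncomputable def specialize {P : Fin k → ℂ} (hP : P ∈ admissible k) : WeightRing k →+* ℂ :=
  IsLocalization.lift (M := partialSums k) (isUnit_eval_partialSums hP)

theorem specialize_genericWeight {P : Fin k → ℂ} (hP : P ∈ admissible k) (i : Fin k) :
    specialize hP (genericWeight k i) = P i := by
  rw [specialize, genericWeight, IsLocalization.lift_eq, MvPolynomial.eval_X]

/-- If the first `N` coefficients generate all others over the space of admissible weights, they
do so at each single admissible weight. -/
theorem psumAlgebra_eq_adjoin_of_familyRing_eq {P : Fin k → ℂ} (hP : P ∈ admissible k) {N : ℕ}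
    (h : ∀ i, N ≤ i → familyRing k i = familyRing k N) :
    psumAlgebra P = Algebra.adjoin ℂ (Set.range fun i : Fin N => weightedPsum P (i + 1)) := by
  set A := Algebra.adjoin (WeightRing k)
    (Set.range fun i : Fin N => weightedPsum (genericWeight k) (i + 1)) with hA
  have hgen : ∀ j, 1 ≤ j → weightedPsum (genericWeight k) j ∈ A := by
    intro j hj
    have h1 : weightedPsum (genericWeight k) j ∈ familyRing k (max N j) :=
      familyRing_le_iff.1 le_rfl j hj (le_max_right _ _)
    rw [h _ (le_max_left _ _)] at h1
    refine familyRing_le_iff.2 (fun i hi1 hi2 => ?_) h1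
    refine Algebra.subset_adjoin ⟨⟨i - 1, by omega⟩, ?_⟩
    simp only [Nat.sub_add_cancel hi1]
  have hmap : ∀ j, MvPolynomial.map (specialize hP) (weightedPsum (genericWeight k) j) =
      weightedPsum P j := fun j => by
    simp [weightedPsum, specialize_genericWeight]
  have hspec : ∀ f ∈ A, MvPolynomial.map (specialize hP) f ∈
      Algebra.adjoin ℂ (Set.range fun i : Fin N => weightedPsum P (i + 1)) := by
    intro f hf
    induction hf using Algebra.adjoin_induction with
    | mem f hf =>
      obtain ⟨i, rfl⟩ := hf
      rw [hmap]
      exact Algebra.subset_adjoin ⟨i, rfl⟩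
    | algebraMap c =>
      rw [MvPolynomial.algebraMap_eq, MvPolynomial.map_C]
      exact Subalgebra.algebraMap_mem _ _
    | add f g _ _ hf hg => rw [map_add]; exact Subalgebra.add_mem _ hf hg
    | mul f g _ _ hf hg => rw [map_mul]; exact Subalgebra.mul_mem _ hf hg
  apply le_antisymm
  · refine Algebra.adjoin_le ?_
    rintro _ ⟨j, hj, rfl⟩
    rw [← hmap]
    exact hspec _ (hgen j hj)
  · refine Algebra.adjoin_le ?_
    rintro _ ⟨i, rfl⟩
    exact Algebra.subset_adjoin ⟨i + 1, by omega, rfl⟩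

theorem uniformDim_eq (h1 : 1 ≤ k) (h3 : k ≤ 3) : uniformDim k = (2 ^ k - 1 : ℕ) := by
  apply le_antisymm
  · exact iInf₂_le _ fun i hi => familyRing_eq_of_le h1 h3 hi
  · refine le_iInf₂ fun N hN => ?_
    have hP : (fun i => (binaryWeight k i : ℂ)) ∈ admissible k :=
      natCast_mem_admissible fun i => Nat.two_pow_pos _
    exact_mod_cast two_pow_sub_one_le_of_adjoin_eq (h3.trans (by norm_num)) _
      (psumAlgebra_eq_adjoin_of_familyRing_eq hP hN)

end Family

end IncidenceStrata

theorem theorem1p5 :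
    (∀ k : ℕ, 1 ≤ k → k ≤ 3 →
      IsGreatest {d : ℕ∞ | ∃ m : Fin k → ℕ, (∀ i, 0 < m i) ∧
          d = IncidenceStrata.embDim (fun i => (m i : ℂ))} ((2 ^ k - 1 : ℕ) : ℕ∞) ∧
      IsGreatest {d : ℕ∞ | ∃ P ∈ IncidenceStrata.admissible k,
          d = IncidenceStrata.embDim P} ((2 ^ k - 1 : ℕ) : ℕ∞) ∧
      IncidenceStrata.uniformDim k = ((2 ^ k - 1 : ℕ) : ℕ∞)) ∧
    IncidenceStrata.embDim ![(1 : ℂ), 2, 4, 8] = 15 := by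
  open IncidenceStrata in
  refine ⟨fun k h1 h3 => ?_, ?_⟩
  · have hpos : ∀ i, 0 < binaryWeight k i := fun i => Nat.two_pow_pos _
    have hadm := natCast_mem_admissible hpos
    have heq : ((2 ^ k - 1 : ℕ) : ℕ∞) = embDim (fun i => (binaryWeight k i : ℂ)) :=
      le_antisymm (two_pow_sub_one_le_embDim (by omega)) (embDim_le_of_admissible h1 h3 hadm)
    refine ⟨⟨⟨_, hpos, heq⟩, ?_⟩, ⟨⟨_, hadm, heq⟩, ?_⟩, uniformDim_eq h1 h3⟩
    · rintro _ ⟨m, hm, rfl⟩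
      exact embDim_le_of_admissible h1 h3 (natCast_mem_admissible hm)
    · rintro _ ⟨P, hP, rfl⟩
      exact embDim_le_of_admissible h1 h3 hP
  · have hw : ![(1 : ℂ), 2, 4, 8] = fun i => (binaryWeight 4 i : ℂ) := by
      ext i
      fin_cases i <;> simp [binaryWeight]
    rw [hw]
    refine le_antisymm ((embDim_natCast_le _).trans_eq ?_) (two_pow_sub_one_le_embDim le_rfl)
    rfl
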